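/- Let $d\ge 0$, let $\mathcal I$ be a non-empty finite set, and for each $i\in\mathcal I$ let $S_i:\mathbb R^d\to\mathbb R^d$ be a contracting similarity, i.e. $|S_i(x)-S_i(y)|=r_i|x-y|$ for all $x,y\in\mathbb R^d$, for some $r_i\in(0,1)$. Let $K$ be the attractor of $\{S_i\}$, the unique non-empty compact set with $K=\bigcup_{i\in\mathcal I}S_i(K)$, and assume the strong separation condition: $S_i(K)\cap S_j(K)=\varnothing$ for all $i\ne j$. Let $p=(p_i)_{i\in\mathcal I}$ be any probability vector ($p_i\ge 0$, $\sum_i p_i=1$; zero entries are allowed), and let $\mu=\mu_p$ be the self-similar measure, the unique Borel probability measure on $\mathbb R^d$ with $\mu=\sum_{i\in\mathcal I}p_i\,\mu\circ S_i^{-1}$. Write $B(x,r)$ for the closed ball. Define the multifractal spectrum $$f_\mu(\alpha)=\dim_H\Bigl\{x\in\operatorname{supp}\mu:\ \lim_{r\to0^+}\frac{\log\mu(B(x,r))}{\log r}\text{ exists and equals }\alpha\Bigr\},\qquad \alpha\in\mathbb R,$$ where $\dim_H$ is Hausdorff dimension with the convention $\dim_H\varnothing=-\infty$; the $L^q$-spectrum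 $$\tau_\mu(q)=\liminf_{r\to0^+}\frac{\log G_\mu(r,q)}{\log r},\qquad G_\mu(r,q)=\sup\Bigl\{\sum_{x\in X}\mu(B(x,r))^q:\ X\subset\operatorname{supp}\mu,\ |x-y|>2r\text{ for all distinct }x,y\in X\Bigr\},\qquad q\in\mathbb R;$$ and its concave conjugate $\tau_\mu^*(\alpha)=\inf_{q\in\mathbb R}\bigl(q\alpha-\tau_\mu(q)\bigr)\in[-\infty,\infty]$. **Theorem.** $\mu_p$ satisfies the multifractal formalism: $f_{\mu_p}(\alpha)=\tau_{\mu_p}^*(\alpha)$ for every $\alpha\in\mathbb R$ (including the endpoints of the spectrum, and with both sides equal to $-\infty$ when no point of the support has local dimension $\alpha$). -/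

import Mathlib

open Set Filter Topology MeasureTheory
open scoped ENNReal NNReal BoundedContinuousFunction

/-! ### Self-similar iterated function systems -/

/-- `S` is a contracting similarity: `|S x - S y| = r |x - y|` for some `r ∈ (0, 1)`. -/
def IsContractingSimilarity {E : Type*} [MetricSpace E] (S : E → E) : Prop :=
  ∃ r : ℝ, 0 < r ∧ r < 1 ∧ ∀ x y, dist (S x) (S y) = r * dist x y

/-- A family of contracting similarities of `E` indexed by `ι` (finite wherever it is used). -/
structure SimilarityIFS (ι : Type*) (E : Type*) [MetricSpace E] where
  map : ι → E → E
  isSimilarity : ∀ i, IsContractingSimilarity (map i)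

namespace SimilarityIFS

/-- `K` is a nonempty compact set with `K = ⋃ i, S i (K)`. -/
def IsAttractor {ι E : Type*} [MetricSpace E] (F : SimilarityIFS ι E) (K : Set E) : Prop :=
  IsCompact K ∧ K.Nonempty ∧ K = ⋃ i, F.map i '' K

/-- `μ` is a Borel probability measure with `μ = ∑ i, p i • μ ∘ (S i)⁻¹`. -/
def IsInvariantMeasure {ι E : Type*} [Fintype ι] [MetricSpace E] [MeasurableSpace E]
    (F : SimilarityIFS ι E) (p : ι → ℝ) (μ : Measure E) : Prop :=
  IsProbabilityMeasure μ ∧ μ = ∑ i, ENNReal.ofReal (p i) • μ.map (F.map i)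

/-- `S_{ω 0} ∘ ⋯ ∘ S_{ω (n-1)}`. -/
def wordMap {ι E : Type*} [MetricSpace E] (F : SimilarityIFS ι E) (ω : ℕ → ι) : ℕ → E → E
  | 0 => id
  | n + 1 => fun x => wordMap F ω n (F.map (ω n) x)

/-- Prepend a letter to an infinite word. -/
def consWord {ι : Type*} (i : ι) (ω : ℕ → ι) : ℕ → ι
  | 0 => i
  | n + 1 => ω n

section Coding

variable {ι E : Type*} [MetricSpace E]

theorem wordMap_cons (F : SimilarityIFS ι E) (i : ι) (ω : ℕ → ι) (n : ℕ) (x : E) :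
    F.wordMap (consWord i ω) (n + 1) x = F.map i (F.wordMap ω n x) := by
  induction n generalizing x with
  | zero => rfl
  | succ n ih => exact ih (F.map (ω n) x)

theorem continuous_map (F : SimilarityIFS ι E) (i : ι) : Continuous (F.map i) := by
  obtain ⟨r, h0, _, hr⟩ := F.isSimilarity i
  exact (LipschitzWith.of_dist_le_mul (K := ⟨r, h0.le⟩) fun x y => (hr x y).le).continuous

theorem exists_ratio_bound [Finite ι] (F : SimilarityIFS ι E) :
    ∃ ρ : ℝ, 0 < ρ ∧ ρ < 1 ∧ ∀ ω n x y,
      dist (F.wordMap ω n x) (F.wordMap ω n y) ≤ ρ ^ n * dist x y := by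
  choose r h0 h1 hr using F.isSimilarity
  obtain ⟨ρ, hρ0, hρ1, hρ⟩ : ∃ ρ : ℝ, 0 < ρ ∧ ρ < 1 ∧ ∀ i, r i ≤ ρ := by
    cases isEmpty_or_nonempty ι
    · exact ⟨1 / 2, by norm_num, by norm_num, fun i => isEmptyElim i⟩
    · obtain ⟨i, hi⟩ := Finite.exists_max r
      exact ⟨r i, h0 i, h1 i, hi⟩
  refine ⟨ρ, hρ0, hρ1, fun ω n => ?_⟩
  induction n with
  | zero => intro x y; simp [wordMap]
  | succ n ih =>
    intro x y
    calc _ ≤ ρ ^ n * dist (F.map (ω n) x) (F.map (ω n) y) := ih _ _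
      _ ≤ ρ ^ n * (ρ * dist x y) := by
        rw [hr]
        have := hρ (ω n)
        gcongr
      _ = _ := by ring

/-- For each infinite word, the images of all points converge to a common limit, uniformly in the
word. -/
theorem exists_coding [Finite ι] [CompleteSpace E] [Nonempty E] (F : SimilarityIFS ι E) :
    ∃ π : (ℕ → ι) → E,
      (∀ ω (x : ℕ → E) (C : ℝ), (∀ n, dist (x n) (x 0) ≤ C) →
        Tendsto (fun n => F.wordMap ω n (x n)) atTop (𝓝 (π ω))) ∧
      ∀ x : E, TendstoUniformly (fun n ω => F.wordMap ω n x) π atTop := by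
  obtain ⟨ρ, hρ0, hρ1, hρ⟩ := F.exists_ratio_bound
  obtain ⟨x₀⟩ := ‹Nonempty E›
  obtain ⟨C, hC0, hC⟩ : ∃ C : ℝ, 0 ≤ C ∧ ∀ i, dist x₀ (F.map i x₀) ≤ C := by
    cases nonempty_fintype ι
    exact ⟨∑ i, dist x₀ (F.map i x₀), Finset.sum_nonneg fun _ _ => dist_nonneg, fun i =>
      Finset.single_le_sum (f := fun i => dist x₀ (F.map i x₀))
        (fun _ _ => dist_nonneg) (Finset.mem_univ i)⟩
  have hstep : ∀ ω n, dist (F.wordMap ω n x₀) (F.wordMap ω (n + 1) x₀) ≤ C * ρ ^ n := by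
    intro ω n
    refine (hρ ω n x₀ (F.map (ω n) x₀)).trans ?_
    rw [mul_comm]
    gcongr
    exact hC _
  have hcau : ∀ ω, ∃ y, Tendsto (fun n => F.wordMap ω n x₀) atTop (𝓝 y) := fun ω =>
    cauchySeq_tendsto_of_complete (cauchySeq_of_le_geometric ρ C hρ1 (hstep ω))
  choose π hπ using hcau
  have hpow : Tendsto (fun n : ℕ => ρ ^ n) atTop (𝓝 0) :=
    tendsto_pow_atTop_nhds_zero_of_lt_one hρ0.le hρ1
  have hbd : ∀ ω n, dist (F.wordMap ω n x₀) (π ω) ≤ C * ρ ^ n / (1 - ρ) := fun ω n =>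
    dist_le_of_le_geometric_of_tendsto ρ C hρ1 (hstep ω) (hπ ω) n
  have hbd' : ∀ ω n x, dist (π ω) (F.wordMap ω n x) ≤ ρ ^ n * (C / (1 - ρ) + dist x₀ x) := by
    intro ω n x
    have h1 := hbd ω n
    have h2 := hρ ω n x₀ x
    have h3 := dist_triangle (π ω) (F.wordMap ω n x₀) (F.wordMap ω n x)
    rw [dist_comm] at h1
    calc _ ≤ C * ρ ^ n / (1 - ρ) + ρ ^ n * dist x₀ x := by linarith
      _ = _ := by ring
  refine ⟨π, fun ω x D hD => ?_, fun x => ?_⟩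
  · rw [tendsto_iff_dist_tendsto_zero]
    refine squeeze_zero (fun _ => dist_nonneg)
      (g := fun n => ρ ^ n * (C / (1 - ρ) + (dist x₀ (x 0) + D))) (fun n => ?_) ?_
    · rw [dist_comm]
      refine (hbd' ω n (x n)).trans ?_
      have := dist_triangle x₀ (x 0) (x n)
      have h4 := hD n
      rw [dist_comm] at h4
      gcongr
      linarith
    · simpa using hpow.mul_const (C / (1 - ρ) + (dist x₀ (x 0) + D))
  · rw [Metric.tendstoUniformly_iff]
    intro ε hε
    have hlim : Tendsto (fun n => ρ ^ n * (C / (1 - ρ) + dist x₀ x)) atTop (𝓝 0) := by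
      simpa using hpow.mul_const (C / (1 - ρ) + dist x₀ x)
    filter_upwards [hlim.eventually_lt_const hε] with n hn ω
    exact (hbd' ω n x).trans_lt hn

theorem continuous_wordMap [TopologicalSpace ι] [DiscreteTopology ι] (F : SimilarityIFS ι E)
    (n : ℕ) : Continuous fun z : (ℕ → ι) × E => F.wordMap z.1 n z.2 := by
  have key : ∀ n, ∀ g : (ℕ → ι) × E → E, Continuous g →
      Continuous fun z : (ℕ → ι) × E => F.wordMap z.1 n (g z) := by
    intro n
    induction n with
    | zero => intro g hg; exact hg
    | succ n ih =>
      intro g hg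
      refine ih (fun z => F.map (z.1 n) (g z)) ?_
      rw [continuous_iff_continuousAt]
      intro z
      have hev : (fun z' : (ℕ → ι) × E => F.map (z.1 n) (g z')) =ᶠ[𝓝 z]
          fun z' => F.map (z'.1 n) (g z') := by
        have hc : Continuous fun z' : (ℕ → ι) × E => z'.1 n := by fun_prop
        have : ∀ᶠ z' : (ℕ → ι) × E in 𝓝 z, z'.1 n = z.1 n :=
          hc.continuousAt.eventually
            (show ∀ᶠ i in 𝓝 (z.1 n), i = z.1 n by simp [nhds_discrete])
        filter_upwards [this] with z' h
        rw [h]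
      exact ((F.continuous_map (z.1 n)).comp hg).continuousAt.congr hev
  exact key n _ continuous_snd

theorem coding_cons (F : SimilarityIFS ι E) {π : (ℕ → ι) → E} {x₀ : E}
    (h : ∀ ω, Tendsto (fun n => F.wordMap ω n x₀) atTop (𝓝 (π ω))) (i : ι) (ω : ℕ → ι) :
    π (consWord i ω) = F.map i (π ω) := by
  have h1 := (tendsto_add_atTop_iff_nat 1).2 (h (consWord i ω))
  have h2 := ((F.continuous_map i).tendsto _).comp (h ω)
  refine tendsto_nhds_unique h1 (h2.congr fun n => ?_)
  exact (F.wordMap_cons i ω n x₀).symm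

end Coding

/-- Hutchinson: the attractor exists and is unique. -/
theorem existsUnique_isAttractor {ι E : Type*} [Finite ι] [Nonempty ι] [MetricSpace E]
    [CompleteSpace E] [Nonempty E] (F : SimilarityIFS ι E) : ∃! K : Set E, F.IsAttractor K := by
  let _ : TopologicalSpace ι := ⊥
  have _ : DiscreteTopology ι := ⟨rfl⟩
  obtain ⟨π, hπ, hunif⟩ := F.exists_coding
  obtain ⟨x₀⟩ := ‹Nonempty E›
  have hcont : Continuous π := (hunif x₀).continuous (Frequently.of_forall fun n =>
    (F.continuous_wordMap n).comp (Continuous.prodMk_left x₀))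
  have hcons : ∀ i ω, π (consWord i ω) = F.map i (π ω) :=
    F.coding_cons fun ω => hπ ω (fun _ => x₀) 0 (by simp)
  have hcw : ∀ ω : ℕ → ι, consWord (ω 0) (fun n => ω (n + 1)) = ω := by
    intro ω; funext n; cases n <;> rfl
  refine ⟨range π, ⟨isCompact_range hcont, range_nonempty π, ?_⟩, ?_⟩
  · ext y
    simp only [mem_range, mem_iUnion, mem_image]
    constructor
    · rintro ⟨ω, rfl⟩
      exact ⟨ω 0, _, ⟨fun n => ω (n + 1), rfl⟩, by rw [← hcons, hcw]⟩
    · rintro ⟨i, _, ⟨ω, rfl⟩, rfl⟩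
      exact ⟨consWord i ω, hcons i ω⟩
  · rintro K ⟨hK, hne, hKeq⟩
    have hsub : ∀ i, ∀ x ∈ K, F.map i x ∈ K := fun i x hx => by
      rw [hKeq]; exact mem_iUnion.2 ⟨i, x, hx, rfl⟩
    have hex : ∀ x : K, ∃ q : ι × K, F.map q.1 q.2 = x := by
      rintro ⟨x, hx⟩
      rw [hKeq] at hx
      obtain ⟨i, y, hy, h⟩ := mem_iUnion.1 hx
      exact ⟨(i, ⟨y, hy⟩), h⟩
    choose q hq using hex
    obtain ⟨D, hD⟩ := Metric.isBounded_iff.1 hK.isBounded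
    apply Subset.antisymm
    · intro x hx
      let s : ℕ → K := fun n => (fun z => (q z).2)^[n] ⟨x, hx⟩
      have hs : ∀ n, s (n + 1) = (q (s n)).2 := fun n => Function.iterate_succ_apply' _ _ _
      let ω : ℕ → ι := fun n => (q (s n)).1
      have hw : ∀ n, F.wordMap ω n (s n) = x := by
        intro n
        induction n with
        | zero => rfl
        | succ n ih =>
          show F.wordMap ω n (F.map (ω n) (s (n + 1))) = x
          rw [hs, hq, ih]
      have hl := hπ ω (fun n => s n) D fun n => hD (s n).2 (s 0).2
      refine ⟨ω, tendsto_nhds_unique hl ?_⟩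
      simp [hw]
    · rintro _ ⟨ω, rfl⟩
      obtain ⟨k, hk⟩ := hne
      have hl := hπ ω (fun _ => k) 0 (by simp)
      refine hK.isClosed.mem_of_tendsto hl (Eventually.of_forall fun n => ?_)
      have : ∀ n, ∀ z ∈ K, F.wordMap ω n z ∈ K := by
        intro n
        induction n with
        | zero => intro z hz; exact hz
        | succ n ih => intro z hz; exact ih _ (hsub _ _ hz)
      exact this n k hk

theorem measurable_consWord {ι : Type*} [MeasurableSpace ι] (i : ι) : Measurable (consWord i) := by
  refine measurable_pi_lambda _ fun n => ?_
  cases n with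
  | zero => exact measurable_const
  | succ n => exact measurable_pi_apply n

/-- The Bernoulli measure exists. -/
theorem exists_bernoulli {ι : Type*} [Fintype ι] [MeasurableSpace ι]
    [DiscreteMeasurableSpace ι] {p : ι → ℝ} (hp : p ∈ stdSimplex ℝ ι) :
    ∃ Q : Measure (ℕ → ι), IsProbabilityMeasure Q ∧
      Q = ∑ i, ENNReal.ofReal (p i) • Q.map (consWord i) := by
  classical
  let P : Measure ι := ∑ i, ENNReal.ofReal (p i) • Measure.dirac i
  have hPapp : ∀ A : Set ι, P A = ∑ i, ENNReal.ofReal (p i) * A.indicator 1 i := by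
    intro A
    simp [P, Measure.finsetSum_apply]
  have hP : IsProbabilityMeasure P := ⟨by
    rw [hPapp]
    simp [← ENNReal.ofReal_sum_of_nonneg fun i _ => hp.1 i, hp.2]⟩
  let Q : Measure (ℕ → ι) := Measure.infinitePi fun _ => P
  refine ⟨Q, inferInstance, ?_⟩
  symm
  refine Measure.eq_infinitePi (fun _ => P) fun s t ht => ?_
  obtain ⟨N, hN⟩ : ∃ N, s ⊆ Finset.range (N + 1) := by
    obtain ⟨N, hN⟩ := s.exists_nat_subset_range
    exact ⟨N, hN.trans (Finset.range_mono (Nat.le_succ N))⟩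
  let t' : ℕ → Set ι := fun n => if n ∈ s then t n else univ
  have hset : Set.pi (s : Set ℕ) t = Set.pi (Finset.range (N + 1) : Set ℕ) t' := by
    ext ω
    simp only [Set.mem_pi, Finset.mem_coe, t']
    constructor
    · intro h n _
      split_ifs with hn
      · exact h n hn
      · trivial
    · intro h n hn
      simpa [hn] using h n (hN hn)
  have hprod : ∏ n ∈ s, P (t n) = ∏ n ∈ Finset.range (N + 1), P (t' n) := by
    rw [← Finset.prod_subset hN]
    · exact Finset.prod_congr rfl fun n hn => by simp [t', hn]
    · intro n _ hn
      simp [t', hn]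
  have hmt : ∀ n, MeasurableSet (t' n) := fun n => MeasurableSet.of_discrete
  rw [hset, hprod, Finset.prod_range_succ', hPapp (t' 0), Measure.finsetSum_apply, Finset.mul_sum]
  refine Finset.sum_congr rfl fun i _ => ?_
  rw [Measure.smul_apply, Measure.map_apply (measurable_consWord i)
    (MeasurableSet.pi (Finset.countable_toSet _) fun n _ => hmt n), smul_eq_mul]
  have hpre : consWord i ⁻¹' Set.pi (Finset.range (N + 1) : Set ℕ) t' =
      if i ∈ t' 0 then Set.pi (Finset.range N : Set ℕ) (fun n => t' (n + 1)) else ∅ := by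
    ext ω
    split_ifs with h0
    · simp only [mem_preimage, Set.mem_pi, Finset.coe_range, mem_Iio]
      constructor
      · intro h n hn
        exact h (n + 1) (by omega)
      · intro h n hn
        cases n with
        | zero => exact h0
        | succ n => exact h n (by omega)
    · simp only [mem_preimage, Set.mem_pi, Finset.coe_range, mem_Iio, mem_empty_iff_false,
        iff_false]
      intro h
      exact h0 (h 0 (by omega))
  rw [hpre]
  split_ifs with h0
  · rw [Measure.infinitePi_pi _ fun n _ => hmt (n + 1)]
    simp [h0, mul_comm]
  · simp [h0]

/-- Hutchinson: the invariant measure exists and is unique. -/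
theorem existsUnique_isInvariantMeasure {ι E : Type*} [Fintype ι] [MetricSpace E]
    [CompleteSpace E] [SecondCountableTopology E] [Nonempty E] [MeasurableSpace E] [BorelSpace E]
    (F : SimilarityIFS ι E) {p : ι → ℝ} (hp : p ∈ stdSimplex ℝ ι) :
    ∃! μ : Measure E, F.IsInvariantMeasure p μ := by
  let _ : TopologicalSpace ι := ⊥
  have _ : DiscreteTopology ι := ⟨rfl⟩
  let _ : MeasurableSpace ι := ⊤
  have _ : DiscreteMeasurableSpace ι := ⟨fun _ => trivial⟩
  obtain ⟨Q, hQ, hQinv⟩ := exists_bernoulli hp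
  obtain ⟨π, hπ, hunif⟩ := F.exists_coding
  obtain ⟨x₀⟩ := ‹Nonempty E›
  have hcont : Continuous π := (hunif x₀).continuous (Frequently.of_forall fun n =>
    (F.continuous_wordMap n).comp (Continuous.prodMk_left x₀))
  have hcons : ∀ i ω, π (consWord i ω) = F.map i (π ω) :=
    F.coding_cons fun ω => hπ ω (fun _ => x₀) 0 (by simp)
  have hmS : ∀ i, Measurable (F.map i) := fun i => (F.continuous_map i).measurable
  have hint : ∀ h : (ℕ → ι) → ℝ≥0∞, Measurable h →
      ∫⁻ ω, h ω ∂Q = ∑ i, ENNReal.ofReal (p i) * ∫⁻ ω, h (consWord i ω) ∂Q := by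
    intro h hh
    conv_lhs => rw [hQinv]
    rw [lintegral_finsetSum_measure]
    refine Finset.sum_congr rfl fun i _ => ?_
    rw [lintegral_smul_measure, lintegral_map hh (measurable_consWord i), smul_eq_mul]
  refine ⟨Q.map π, ⟨Measure.isProbabilityMeasure_map hcont.measurable.aemeasurable, ?_⟩, ?_⟩
  · ext A hA
    rw [Measure.finsetSum_apply, ← lintegral_indicator_one hA,
      lintegral_map (measurable_one.indicator hA) hcont.measurable,
      hint (fun ω => A.indicator 1 (π ω)) ((measurable_one.indicator hA).comp hcont.measurable)]
    refine Finset.sum_congr rfl fun i _ => ?_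
    rw [Measure.smul_apply, smul_eq_mul, ← lintegral_indicator_one hA,
      lintegral_map (measurable_one.indicator hA) (hmS i),
      lintegral_map (f := fun x => A.indicator 1 (F.map i x))
        ((measurable_one.indicator hA).comp (hmS i)) hcont.measurable]
    simp only [hcons]
  · rintro μ ⟨hμ, hinv⟩
    have hword : ∀ n, ∀ g : E → ℝ≥0∞, Measurable g →
        ∫⁻ ω, ∫⁻ x, g (F.wordMap ω n x) ∂μ ∂Q = ∫⁻ x, g x ∂μ := by
      intro n
      induction n with
      | zero => intro g hg; simp [wordMap]
      | succ n ih =>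
        intro g hg
        rw [hint]
        · simp only [wordMap_cons]
          conv_rhs => rw [hinv]
          rw [lintegral_finsetSum_measure]
          refine Finset.sum_congr rfl fun i _ => ?_
          rw [lintegral_smul_measure, lintegral_map hg (hmS i), smul_eq_mul,
            ← ih (fun x => g (F.map i x)) (hg.comp (hmS i))]
        · exact Measurable.lintegral_prod_right'
            (f := fun z : (ℕ → ι) × E => g (F.wordMap z.1 (n + 1) z.2))
            (hg.comp (F.continuous_wordMap (n + 1)).measurable)
    have hprob := Measure.isProbabilityMeasure_map (μ := Q) hcont.measurable.aemeasurable
    refine ext_of_forall_lintegral_eq_of_IsFiniteMeasure fun f => ?_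
    have hfm : Measurable fun x => (f x : ℝ≥0∞) := by fun_prop
    rw [lintegral_map hfm hcont.measurable]
    have hlim : Tendsto (fun n => ∫⁻ z, (f (F.wordMap z.1 n z.2) : ℝ≥0∞) ∂(Q.prod μ)) atTop
        (𝓝 (∫⁻ z, (f (π z.1) : ℝ≥0∞) ∂(Q.prod μ))) := by
      refine tendsto_lintegral_of_dominated_convergence (fun _ => (nndist f 0 : ℝ≥0∞))
        (fun n => hfm.comp (F.continuous_wordMap n).measurable)
        (fun n => Eventually.of_forall fun z => ?_) (by simp)
        (Eventually.of_forall fun z => ?_)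
      · exact ENNReal.coe_le_coe.2 (BoundedContinuousFunction.NNReal.upper_bound f _)
      · refine (ENNReal.continuous_coe.tendsto _).comp ((f.continuous.tendsto _).comp ?_)
        exact hπ z.1 (fun _ => z.2) 0 (by simp)
    have hconst : ∀ n, ∫⁻ z, (f (F.wordMap z.1 n z.2) : ℝ≥0∞) ∂(Q.prod μ) = ∫⁻ x, f x ∂μ := by
      intro n
      rw [lintegral_prod (fun z => (f (F.wordMap z.1 n z.2) : ℝ≥0∞))
        (hfm.comp (F.continuous_wordMap n).measurable).aemeasurable]
      exact hword n _ hfm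
    simp only [hconst] at hlim
    rw [tendsto_nhds_unique tendsto_const_nhds hlim,
      lintegral_prod (fun z => (f (π z.1) : ℝ≥0∞))
        (hfm.comp (hcont.measurable.comp measurable_fst)).aemeasurable]
    simp

/-- The attractor of an iterated function system. -/
noncomputable def attractor {ι E : Type*} [Finite ι] [Nonempty ι] [MetricSpace E]
    [CompleteSpace E] [Nonempty E] (F : SimilarityIFS ι E) : Set E :=
  F.existsUnique_isAttractor.choose

/-- The self-similar measure `μ_p` of a probability vector `p`. -/
noncomputable def selfSimilarMeasure {ι E : Type*} [Fintype ι] [MetricSpace E]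
    [CompleteSpace E] [SecondCountableTopology E] [Nonempty E] [MeasurableSpace E] [BorelSpace E]
    (F : SimilarityIFS ι E) (p : stdSimplex ℝ ι) : Measure E :=
  (F.existsUnique_isInvariantMeasure p.2).choose

/-- The strong separation condition: the sets `S i (K)` are pairwise disjoint, where `K` is the
attractor. -/
def StrongSeparation {ι E : Type*} [Finite ι] [Nonempty ι] [MetricSpace E]
    [CompleteSpace E] [Nonempty E] (F : SimilarityIFS ι E) : Prop :=
  Pairwise fun i j => Disjoint (F.map i '' F.attractor) (F.map j '' F.attractor)

theorem isAttractor_attractor {ι E : Type*} [Finite ι] [Nonempty ι] [MetricSpace E]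
    [CompleteSpace E] [Nonempty E] (F : SimilarityIFS ι E) : F.IsAttractor F.attractor :=
  F.existsUnique_isAttractor.choose_spec.1

theorem isInvariantMeasure_selfSimilarMeasure {ι E : Type*} [Fintype ι] [MetricSpace E]
    [CompleteSpace E] [SecondCountableTopology E] [Nonempty E] [MeasurableSpace E] [BorelSpace E]
    (F : SimilarityIFS ι E) (p : stdSimplex ℝ ι) :
    F.IsInvariantMeasure p (F.selfSimilarMeasure p) :=
  (F.existsUnique_isInvariantMeasure p.2).choose_spec.1

end SimilarityIFS

/-! ### Local dimensions, multifractal spectrum, `L^q`-spectrum -/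

/-- The local dimension of `μ` at `x` exists and equals `α`: the quotient
`log μ(B(x, r)) / log r` tends to `α` as `r → 0+`. -/
def HasLocalDim {E : Type*} [MetricSpace E] [MeasurableSpace E] (μ : Measure E) (x : E)
    (α : ℝ) : Prop :=
  Tendsto (fun r : ℝ => ENNReal.log (μ (Metric.closedBall x r)) / (Real.log r : EReal))
    (𝓝[>] 0) (𝓝 (α : EReal))

/-- The points of the support of `μ` at which the local dimension is `α`. -/
def localDimLevelSet {E : Type*} [MetricSpace E] [MeasurableSpace E] (μ : Measure E)
    (α : ℝ) : Set E :=
  {x | x ∈ μ.support ∧ HasLocalDim μ x α}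

open Classical in
/-- The Hausdorff dimension, with the convention that the empty set has dimension `-∞`. -/
noncomputable def hausdorffDim {E : Type*} [MetricSpace E] (A : Set E) : EReal :=
  if A = ∅ then ⊥ else (dimH A : EReal)

/-- The multifractal spectrum of `μ`. -/
noncomputable def multifractalSpectrum {E : Type*} [MetricSpace E] [MeasurableSpace E]
    (μ : Measure E) (α : ℝ) : EReal :=
  hausdorffDim (localDimLevelSet μ α)

/-- `G_μ(r, q)`: the supremum of `∑ μ(B(x, r)) ^ q` over the `2r`-separated subsets of the
support. -/
noncomputable def packingMoment {E : Type*} [MetricSpace E] [MeasurableSpace E]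
    (μ : Measure E) (r q : ℝ) : ℝ≥0∞ :=
  ⨆ (s : Set E) (_ : s ⊆ μ.support) (_ : Metric.IsSeparated (ENNReal.ofReal (2 * r)) s),
    ∑' x : s, μ (Metric.closedBall (x : E) r) ^ q

/-- The `L^q`-spectrum `τ_μ(q) = liminf_{r → 0+} log G_μ(r, q) / log r`. -/
noncomputable def lqSpectrum {E : Type*} [MetricSpace E] [MeasurableSpace E]
    (μ : Measure E) (q : ℝ) : EReal :=
  liminf (fun r : ℝ => ENNReal.log (packingMoment μ r q) / (Real.log r : EReal)) (𝓝[>] 0)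

/-- The concave conjugate `g*(α) = inf_q (q α - g(q))`. -/
noncomputable def concaveConjugate (g : ℝ → EReal) (α : ℝ) : EReal :=
  ⨅ q : ℝ, ((q * α : ℝ) : EReal) - g q

/-- The multifractal formalism: `f_μ(α) = τ_μ*(α)` for every real `α`. -/
def SatisfiesMultifractalFormalism {E : Type*} [MetricSpace E] [MeasurableSpace E]
    (μ : Measure E) : Prop :=
  ∀ α : ℝ, multifractalSpectrum μ α = concaveConjugate (lqSpectrum μ) α

/-!
Let `K` be the attractor and `π` the coding map from infinite words to `K`. Strong separation makes
`π` bi-Lipschitz for the ultrametric on words in which two words that share exactly the letters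
`ω 0, …, ω (n - 1)` are at distance `R ω n = r (ω 0) ⋯ r (ω (n - 1))` (`IsSeparatedCoding`,
`SimilarityIFS.exists_isSeparatedCoding`). A self-similar measure is the image of a Bernoulli
measure, and balls can be replaced by cylinders of comparable size at the price of multiplicative
constants (`IsSeparatedCoding.exists_measure_closedBall_comparable`), which disappear in quotients
of logarithms. Letters of weight zero are removed from the system beforehand.

For each `q` let `β q` solve `∑ i, p i ^ q * r i ^ (-β) = 1`, and let `ν` be the self-similar
measure with weights `p i ^ q * r i ^ (-β)`. Then `ν (B (x, ρ))` is comparable to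
`μ (B (x, ρ)) ^ q * ρ ^ (-β)`. Summing over separated sets, whose balls are disjoint, and over
maximal separated sets, whose doubled balls cover, shows that the `L^q`-spectrum is `β`
(`IsSeparatedCoding.lqSpectrum_eq`).

Upper bound: at a point of local dimension `α` for `μ`, the measure `ν` has local dimension
`q α - β q`. Covering by cylinders then bounds the dimension of the level set by `q α - β q`, and
this number is nonnegative if the level set is nonempty (`IsSeparatedCoding.multifractalSpectrum_le`).

Lower bound: let `u ≤ q α - β q` for all `q`. It follows that
`∑ i, r i ^ u * exp (q * (log p i - α log r i)) ≥ 1` for all `q`. Minimising over `q`, or letting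
`q` tend to `∞` or `-∞` at the endpoints of the spectrum, produces a probability vector `w` with
`∑ w i (log p i - α log r i) = 0` and `∑ w i log w i ≤ u ∑ w i log r i`
(`exists_equilibrium_weights`). By the law of large numbers, almost every word of the Bernoulli
measure with weights `w` codes a point of local dimension `α`, and at these points that measure has
local dimension at least `u`; the mass distribution principle
(`IsSeparatedCoding.le_dimH_image`) shows that the level set has dimension at least `u`
(`IsSeparatedCoding.le_multifractalSpectrum`). No differentiability of `β` is needed, and the
endpoints are treated with the interior.
-/

/-! ### Words and Bernoulli measures -/

/-- The product `w (ω 0) ⋯ w (ω (n - 1))` of the weights of the first `n` letters of `ω`. -/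
def wordProd {ι : Type*} (w : ι → ℝ) (ω : ℕ → ι) (n : ℕ) : ℝ :=
  ∏ k ∈ Finset.range n, w (ω k)

/-- The law of one random letter: `i` is drawn with probability `w i`. -/
noncomputable def letterMeasure {ι : Type*} [Fintype ι] [MeasurableSpace ι]
    (w : stdSimplex ℝ ι) : Measure ι :=
  ∑ i, ENNReal.ofReal (w.1 i) • Measure.dirac i

/-- The law of an infinite word whose letters are drawn independently with weights `w`. -/
noncomputable def bernoulliMeasure {ι : Type*} [Fintype ι] [MeasurableSpace ι]
    (w : stdSimplex ℝ ι) : Measure (ℕ → ι) :=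
  Measure.infinitePi fun _ => letterMeasure w

section WordProd

variable {ι : Type*} {w : ι → ℝ} {ω ω' : ℕ → ι}

@[simp] theorem wordProd_zero : wordProd w ω 0 = 1 := by simp [wordProd]

theorem wordProd_succ (n : ℕ) : wordProd w ω (n + 1) = wordProd w ω n * w (ω n) :=
  Finset.prod_range_succ _ _

theorem wordProd_pos (hw : ∀ i, 0 < w i) (n : ℕ) : 0 < wordProd w ω n :=
  Finset.prod_pos fun _ _ => hw _

theorem wordProd_nonneg (hw : ∀ i, 0 ≤ w i) (n : ℕ) : 0 ≤ wordProd w ω n :=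
  Finset.prod_nonneg fun _ _ => hw _

theorem wordProd_congr {n : ℕ} (h : ω' ∈ PiNat.cylinder ω n) :
    wordProd w ω' n = wordProd w ω n :=
  Finset.prod_congr rfl fun k hk => by
    rw [PiNat.mem_cylinder_iff.1 h k (Finset.mem_range.1 hk)]

theorem log_wordProd {n : ℕ} (hw : ∀ k, w (ω k) ≠ 0) :
    Real.log (wordProd w ω n) = ∑ k ∈ Finset.range n, Real.log (w (ω k)) :=
  Real.log_prod fun _ _ => hw _

theorem wordProd_add_le {b : ℝ} (hw : ∀ i, 0 ≤ w i) (hb : ∀ i, w i ≤ b) (m n : ℕ) :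
    wordProd w ω (m + n) ≤ b ^ n * wordProd w ω m := by
  induction n with
  | zero => simp
  | succ n ih =>
    rw [← add_assoc, wordProd_succ]
    calc _ ≤ (b ^ n * wordProd w ω m) * b := by
          gcongr
          · exact hw _
          · exact le_trans (wordProd_nonneg hw _) ih
          · exact hb _
      _ = _ := by ring

theorem le_wordProd_add {a : ℝ} (ha : 0 ≤ a) (hw : ∀ i, a ≤ w i) (m n : ℕ) :
    a ^ n * wordProd w ω m ≤ wordProd w ω (m + n) := by
  have hw0 : ∀ i, 0 ≤ w i := fun i => ha.trans (hw i)
  induction n with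
  | zero => simp
  | succ n ih =>
    rw [← add_assoc, wordProd_succ]
    calc _ = (a ^ n * wordProd w ω m) * a := by ring
      _ ≤ _ := by
          gcongr
          · exact wordProd_nonneg hw0 _
          · exact hw _

theorem wordProd_strictAnti (h0 : ∀ i, 0 < w i) (h1 : ∀ i, w i < 1) :
    StrictAnti (wordProd w ω) :=
  strictAnti_nat_of_succ_lt fun n => by
    rw [wordProd_succ]
    exact mul_lt_of_lt_one_right (wordProd_pos h0 n) (h1 _)

/-- A positive weight on a finite alphabet with values below `1` takes values in some
`[a, b] ⊆ (0, 1)`. -/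
theorem exists_weight_bounds [Finite ι] (h0 : ∀ i, 0 < w i) (h1 : ∀ i, w i < 1) :
    ∃ a b : ℝ, 0 < a ∧ a < 1 ∧ 0 < b ∧ b < 1 ∧ (∀ i, a ≤ w i) ∧ ∀ i, w i ≤ b := by
  cases isEmpty_or_nonempty ι
  · exact ⟨1 / 2, 1 / 2, by norm_num, by norm_num, by norm_num, by norm_num,
      fun i => isEmptyElim i, fun i => isEmptyElim i⟩
  · obtain ⟨i, hi⟩ := Finite.exists_min w
    obtain ⟨j, hj⟩ := Finite.exists_max w
    exact ⟨w i, w j, h0 i, h1 i, h0 j, h1 j, hi, hj⟩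

theorem tendsto_wordProd_zero [Finite ι] (h0 : ∀ i, 0 < w i) (h1 : ∀ i, w i < 1) :
    Tendsto (wordProd w ω) atTop (𝓝 0) := by
  obtain ⟨a, b, -, -, hb0, hb1, -, hb⟩ := exists_weight_bounds h0 h1
  refine squeeze_zero (fun n => (wordProd_pos h0 n).le) (fun n => ?_)
    (tendsto_pow_atTop_nhds_zero_of_lt_one hb0.le hb1)
  simpa using wordProd_add_le (ω := ω) (fun i => (h0 i).le) hb 0 n

end WordProd

section Bernoulli

theorem measurableSet_cylinder {ι : Type*} [MeasurableSpace ι]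
    [DiscreteMeasurableSpace ι] (ω : ℕ → ι) (n : ℕ) : MeasurableSet (PiNat.cylinder ω n) := by
  rw [PiNat.cylinder_eq_pi]
  exact MeasurableSet.pi (Finset.countable_toSet _) fun _ _ => MeasurableSet.of_discrete

theorem preimage_consWord_cylinder_succ {ι : Type*} (i : ι) (ω : ℕ → ι) (n : ℕ)
    [Decidable (i = ω 0)] :
    SimilarityIFS.consWord i ⁻¹' PiNat.cylinder ω (n + 1) =
      if i = ω 0 then PiNat.cylinder (fun k => ω (k + 1)) n else ∅ := by
  ext η
  split_ifs with h
  · simp only [mem_preimage, PiNat.mem_cylinder_iff]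
    constructor
    · exact fun H k hk => H (k + 1) (by omega)
    · intro H k hk
      cases k with
      | zero => exact h
      | succ k => exact H k (by omega)
  · simp only [mem_preimage, PiNat.mem_cylinder_iff, mem_empty_iff_false, iff_false]
    exact fun H => h (H 0 (by omega))

variable {ι : Type*} [Fintype ι] [MeasurableSpace ι] [DiscreteMeasurableSpace ι]

theorem letterMeasure_singleton (w : stdSimplex ℝ ι) (i : ι) :
    letterMeasure w {i} = ENNReal.ofReal (w.1 i) := by
  classical
  rw [letterMeasure, Measure.finsetSum_apply]
  simp [Set.indicator_apply]

instance (w : stdSimplex ℝ ι) : IsProbabilityMeasure (letterMeasure w) := ⟨by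
  rw [letterMeasure, Measure.finsetSum_apply]
  simp [← ENNReal.ofReal_sum_of_nonneg fun i _ => w.2.1 i, w.2.2]⟩

theorem integral_letterMeasure (w : stdSimplex ℝ ι) (g : ι → ℝ) :
    ∫ i, g i ∂(letterMeasure w) = ∑ i, w.1 i * g i := by
  rw [integral_fintype .of_finite]
  simp [Measure.real, letterMeasure_singleton, w.2.1 _]

instance (w : stdSimplex ℝ ι) : IsProbabilityMeasure (bernoulliMeasure w) := by
  unfold bernoulliMeasure; infer_instance

theorem bernoulliMeasure_cylinder (w : stdSimplex ℝ ι) (ω : ℕ → ι) (n : ℕ) :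
    bernoulliMeasure w (PiNat.cylinder ω n) = ENNReal.ofReal (wordProd w.1 ω n) := by
  rw [PiNat.cylinder_eq_pi, bernoulliMeasure,
    Measure.infinitePi_pi _ fun _ _ => MeasurableSet.of_discrete, wordProd,
    ENNReal.ofReal_prod_of_nonneg fun _ _ => w.2.1 _]
  simp [letterMeasure_singleton]

/-- Finite measures on the space of words are determined by the measures of the cylinders. -/
theorem ext_of_cylinder [Nonempty ι] {Q Q' : Measure (ℕ → ι)} [IsFiniteMeasure Q]
    (h : ∀ ω n, Q (PiNat.cylinder ω n) = Q' (PiNat.cylinder ω n)) : Q = Q' := by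
  let _ : TopologicalSpace ι := ⊥
  have _ : DiscreteTopology ι := ⟨rfl⟩
  have hb := PiNat.isTopologicalBasis_cylinders (fun _ : ℕ => ι)
  refine ext_of_generate_finite _ ((BorelSpace.measurable_eq (α := ℕ → ι)).trans
    hb.borel_eq_generateFrom) ?_ ?_ ?_
  · rintro _ ⟨x, m, rfl⟩ _ ⟨y, n, rfl⟩ ⟨z, hzx, hzy⟩
    rw [← PiNat.mem_cylinder_iff_eq.1 hzx, ← PiNat.mem_cylinder_iff_eq.1 hzy]
    rcases le_total m n with h | h
    · exact ⟨z, n, inter_eq_right.2 (PiNat.cylinder_anti z h)⟩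
    · exact ⟨z, m, inter_eq_left.2 (PiNat.cylinder_anti z h)⟩
  · rintro _ ⟨x, n, rfl⟩
    exact h x n
  · obtain ⟨i⟩ := ‹Nonempty ι›
    simpa using h (fun _ => i) 0

theorem bernoulliMeasure_eq_sum_map_consWord [Nonempty ι] (w : stdSimplex ℝ ι) :
    bernoulliMeasure w =
      ∑ i, ENNReal.ofReal (w.1 i) • (bernoulliMeasure w).map (SimilarityIFS.consWord i) := by
  classical
  refine ext_of_cylinder fun ω n => ?_
  rw [Measure.finsetSum_apply]
  simp only [Measure.smul_apply, smul_eq_mul,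
    Measure.map_apply (SimilarityIFS.measurable_consWord _) (measurableSet_cylinder _ _)]
  cases n with
  | zero =>
    simp [← ENNReal.ofReal_sum_of_nonneg fun i _ => w.2.1 i, w.2.2]
  | succ n =>
    simp only [preimage_consWord_cylinder_succ]
    rw [Finset.sum_eq_single (ω 0)]
    · rw [if_pos rfl, bernoulliMeasure_cylinder, bernoulliMeasure_cylinder,
        ← ENNReal.ofReal_mul (w.2.1 _), wordProd, Finset.prod_range_succ', mul_comm, wordProd]
    · intro i _ hi
      simp [hi]
    · simp

/-- Law of large numbers for the letters of a Bernoulli word. -/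
theorem ae_tendsto_letter_average (w : stdSimplex ℝ ι) (g : ι → ℝ) :
    ∀ᵐ ω ∂(bernoulliMeasure w), Tendsto
      (fun n : ℕ => (∑ k ∈ Finset.range n, g (ω k)) / n) atTop (𝓝 (∑ i, w.1 i * g i)) := by
  have hg : Measurable g := measurable_of_finite g
  have hmap : ∀ k, (bernoulliMeasure w).map (fun ω => ω k) = letterMeasure w := fun k =>
    Measure.infinitePi_map_eval _ k
  have hind : ProbabilityTheory.iIndepFun (fun (k : ℕ) (ω : ℕ → ι) => g (ω k))
      (bernoulliMeasure w) := ProbabilityTheory.iIndepFun_infinitePi fun _ => hg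
  have h0 : ∫ ω, g (ω 0) ∂(bernoulliMeasure w) = ∑ i, w.1 i * g i := by
    rw [← integral_letterMeasure, ← hmap 0,
      integral_map (measurable_pi_apply 0).aemeasurable hg.aestronglyMeasurable]
  rw [← h0]
  refine ProbabilityTheory.strong_law_ae_real (fun k (ω : ℕ → ι) => g (ω k)) ?_
    (fun i j hij => hind.indepFun hij) fun k => ?_
  · have : Integrable g ((bernoulliMeasure w).map fun ω => ω 0) := by
      rw [hmap]; exact .of_finite
    exact this.comp_measurable (by fun_prop)
  · exact ProbabilityTheory.IdentDistrib.comp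
      ⟨(measurable_pi_apply k).aemeasurable, (measurable_pi_apply 0).aemeasurable,
        (hmap k).trans (hmap 0).symm⟩ hg

theorem ae_forall_letter_ne_zero (w : stdSimplex ℝ ι) :
    ∀ᵐ ω ∂(bernoulliMeasure w), ∀ k, w.1 (ω k) ≠ 0 := by
  refine ae_all_iff.2 fun k => ?_
  have h : ∀ᵐ i ∂(letterMeasure w), w.1 i ≠ 0 := by
    rw [ae_iff_of_countable]
    intro i hi h0
    exact hi (by rw [letterMeasure_singleton, h0, ENNReal.ofReal_zero])
  have hmap : (bernoulliMeasure w).map (fun ω => ω k) = letterMeasure w :=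
    Measure.infinitePi_map_eval _ k
  rw [← hmap] at h
  exact ae_of_ae_map (f := fun ω : ℕ → ι => ω k) (measurable_pi_apply k).aemeasurable h

end Bernoulli

/-! ### Comparable quantities -/

/-- Quotients are not affected in the limit by bounded perturbations of numerator and denominator
if the denominator is unbounded. -/
theorem tendsto_div_of_bounded_perturbation {α : Type*} {l : Filter α} {a b A B : α → ℝ}
    {c C : ℝ} (hA : ∀ᶠ x in l, |A x - a x| ≤ C) (hB : ∀ᶠ x in l, |B x - b x| ≤ C)
    (hb : Tendsto b l atBot) (hab : Tendsto (fun x => a x / b x) l (𝓝 c)) :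
    Tendsto (fun x => A x / B x) l (𝓝 c) := by
  have key : ∀ f : α → ℝ, (∀ᶠ x in l, |f x| ≤ C) → Tendsto (fun x => f x / b x) l (𝓝 0) := by
    intro f hf
    have hinv : Tendsto (fun x => C * |(b x)⁻¹|) l (𝓝 0) := by
      have := (tendsto_inv_atBot_zero.comp hb).abs.const_mul C
      simpa using this
    refine squeeze_zero_norm' ?_ hinv
    filter_upwards [hf] with x hx
    rw [Real.norm_eq_abs, div_eq_mul_inv, abs_mul]
    gcongr
  have h1 := (hab.add (key _ hA)).div ((key _ hB).const_add 1) (by norm_num)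
  simp only [add_zero, div_one] at h1
  refine h1.congr' ?_
  filter_upwards [hb.eventually_lt_atBot 0] with x hx
  have hx' : b x ≠ 0 := hx.ne
  rw [Pi.div_apply]
  have e1 : a x / b x + (A x - a x) / b x = A x / b x := by field_simp; ring
  have e2 : 1 + (B x - b x) / b x = B x / b x := by field_simp; ring
  rw [e1, e2, div_div_div_cancel_right₀ hx']

theorem abs_log_sub_log_le {a b C : ℝ} (ha : 0 < a) (hb : 0 < b) (hC : 1 ≤ C) (h1 : a ≤ C * b)
    (h2 : b ≤ C * a) : |Real.log a - Real.log b| ≤ Real.log C := by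
  have hC0 : 0 < C := by linarith
  have h3 := Real.log_le_log ha h1
  have h4 := Real.log_le_log hb h2
  rw [Real.log_mul hC0.ne' hb.ne'] at h3
  rw [Real.log_mul hC0.ne' ha.ne'] at h4
  rw [abs_le]
  constructor <;> linarith

/-- Powers, of either sign, of comparable numbers are comparable. -/
theorem rpow_le_mul_rpow_of_comparable {a b C : ℝ} (ha : 0 < a) (hb : 0 < b) (hC : 1 ≤ C)
    (h1 : a ≤ C * b) (h2 : b ≤ C * a) (q : ℝ) : a ^ q ≤ C ^ |q| * b ^ q := by
  have h := abs_le.1 (abs_log_sub_log_le ha hb hC h1 h2)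
  rw [Real.rpow_def_of_pos ha, Real.rpow_def_of_pos hb,
    Real.rpow_def_of_pos (by linarith : 0 < C), ← Real.exp_add, Real.exp_le_exp]
  have h3 : (Real.log a - Real.log b) * q ≤ Real.log C * |q| := by
    calc _ ≤ |Real.log a - Real.log b| * |q| := by rw [← abs_mul]; exact le_abs_self _
      _ ≤ _ := by
        gcongr
        exact abs_le.2 h
  linarith

/-- A quotient of logarithms in the extended reals is the quotient of the real logarithms. -/
theorem ennrealLog_div_log_eq {a : ℝ≥0∞} (h0 : a ≠ 0) (h1 : a ≠ ⊤) (r : ℝ) :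
    ENNReal.log a / (Real.log r : EReal) = ((Real.log a.toReal / Real.log r : ℝ) : EReal) := by
  rw [ENNReal.log_pos_real h0 h1, EReal.coe_div]

/-! ### Separated codings -/

/-- The geometry of a self-similar set with strong separation, seen through its coding map `π`:
points whose words share the first `n` letters `ω 0, …, ω (n - 1)` are at distance at most
`D * r (ω 0) ⋯ r (ω (n - 1))`, and at least `δ * r (ω 0) ⋯ r (ω (n - 1))` if the next letters
differ. -/
structure IsSeparatedCoding {ι E : Type*} [MetricSpace E] (r : ι → ℝ) (π : (ℕ → ι) → E)
    (D δ : ℝ) : Prop where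
  ratio_pos : ∀ i, 0 < r i
  ratio_lt_one : ∀ i, r i < 1
  diam_pos : 0 < D
  gap_pos : 0 < δ
  isCompact_range : IsCompact (range π)
  dist_le : ∀ ω ω' n, ω' ∈ PiNat.cylinder ω n → dist (π ω') (π ω) ≤ D * wordProd r ω n
  le_dist : ∀ ω ω' n, ω' ∈ PiNat.cylinder ω n → ω' n ≠ ω n →
    δ * wordProd r ω n ≤ dist (π ω') (π ω)

namespace IsSeparatedCoding

variable {ι E : Type*} [MetricSpace E] {r : ι → ℝ} {π : (ℕ → ι) → E} {D δ : ℝ}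

theorem wordProd_pos (h : IsSeparatedCoding r π D δ) (ω : ℕ → ι) (n : ℕ) : 0 < wordProd r ω n :=
  _root_.wordProd_pos h.ratio_pos n

theorem strictAnti_wordProd (h : IsSeparatedCoding r π D δ) (ω : ℕ → ι) :
    StrictAnti (wordProd r ω) :=
  wordProd_strictAnti h.ratio_pos h.ratio_lt_one

theorem mem_cylinder_of_dist_le (h : IsSeparatedCoding r π D δ) {ω ω' : ℕ → ι} {n : ℕ}
    (hd : dist (π ω') (π ω) ≤ δ * wordProd r ω n) : ω' ∈ PiNat.cylinder ω n := by
  induction n with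
  | zero => simp
  | succ n ih =>
    have hlt : δ * wordProd r ω (n + 1) < δ * wordProd r ω n :=
      mul_lt_mul_of_pos_left (h.strictAnti_wordProd ω n.lt_succ_self) h.gap_pos
    have hn := ih (hd.trans hlt.le)
    rw [PiNat.mem_cylinder_iff] at hn ⊢
    intro i hi
    rcases Nat.lt_succ_iff_lt_or_eq.1 hi with hi | rfl
    · exact hn i hi
    · by_contra hne
      exact absurd (h.le_dist ω ω' i (PiNat.mem_cylinder_iff.2 hn) hne)
        (not_le.2 (hd.trans_lt hlt))

theorem cylinder_subset_preimage_closedBall (h : IsSeparatedCoding r π D δ) {ω : ℕ → ι} {n : ℕ}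
    {ρ : ℝ} (hρ : D * wordProd r ω n ≤ ρ) :
    PiNat.cylinder ω n ⊆ π ⁻¹' Metric.closedBall (π ω) ρ :=
  fun ω' hω' => (h.dist_le ω ω' n hω').trans hρ

/-- The preimage of a ball of radius comparable to the size of a cylinder is contained in the
cylinder some bounded number of generations above. The subtraction truncates: a cylinder without
enough ancestors is replaced by the whole space. -/
theorem exists_preimage_closedBall_subset [Finite ι] (h : IsSeparatedCoding r π D δ) (C : ℝ) :
    ∃ k : ℕ, ∀ ω n ρ, ρ ≤ C * wordProd r ω n →
      π ⁻¹' Metric.closedBall (π ω) ρ ⊆ PiNat.cylinder ω (n - k) := by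
  obtain ⟨a, b, -, -, hb0, hb1, -, hb⟩ := exists_weight_bounds h.ratio_pos h.ratio_lt_one
  have hlim : Tendsto (fun k : ℕ => C * b ^ k) atTop (𝓝 0) := by
    simpa using (tendsto_pow_atTop_nhds_zero_of_lt_one hb0.le hb1).const_mul C
  obtain ⟨k, hk⟩ : ∃ k : ℕ, C * b ^ k < δ := (hlim.eventually_lt_const h.gap_pos).exists
  refine ⟨k, fun ω n ρ hρ ω' hω' => ?_⟩
  rcases le_total n k with hnk | hnk
  · simp [Nat.sub_eq_zero_of_le hnk]
  · refine h.mem_cylinder_of_dist_le ((Metric.mem_closedBall.1 hω').trans (hρ.trans ?_))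
    have h1 : wordProd r ω n ≤ b ^ k * wordProd r ω (n - k) := by
      have := wordProd_add_le (ω := ω) (fun i => (h.ratio_pos i).le) hb (n - k) k
      rwa [Nat.sub_add_cancel hnk] at this
    have h2 := h.wordProd_pos ω (n - k)
    have h3 := h.wordProd_pos ω n
    rcases le_total 0 C with hC0 | hC0
    · calc _ ≤ C * (b ^ k * wordProd r ω (n - k)) := by gcongr
        _ = (C * b ^ k) * wordProd r ω (n - k) := by ring
        _ ≤ _ := by gcongr
    · exact (mul_nonpos_of_nonpos_of_nonneg hC0 h3.le).trans (mul_pos h.gap_pos h2).le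

/-- Every scale `ρ ≤ 1` is comparable to the size of a cylinder. -/
theorem exists_wordProd_comparable [Finite ι] (h : IsSeparatedCoding r π D δ) :
    ∃ C : ℝ, 1 ≤ C ∧ ∀ ω ρ, 0 < ρ → ρ ≤ 1 →
      ∃ n, D * wordProd r ω n ≤ ρ ∧ ρ ≤ C * wordProd r ω n := by
  obtain ⟨a, b, ha0, ha1, -, -, ha, -⟩ := exists_weight_bounds h.ratio_pos h.ratio_lt_one
  refine ⟨max 1 (D / a), le_max_left _ _, fun ω ρ hρ0 hρ1 => ?_⟩
  have hex : ∃ n, D * wordProd r ω n ≤ ρ := by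
    have hl : Tendsto (fun n => D * wordProd r ω n) atTop (𝓝 0) := by
      simpa using (tendsto_wordProd_zero (ω := ω) h.ratio_pos h.ratio_lt_one).const_mul D
    exact ((hl.eventually_lt_const hρ0).mono fun n hn => hn.le).exists
  classical
  refine ⟨Nat.find hex, Nat.find_spec hex, ?_⟩
  have hpos := h.wordProd_pos ω (Nat.find hex)
  rcases hn : Nat.find hex with _ | n
  · simpa using Or.inl hρ1
  · have h1 : ρ < D * wordProd r ω n := not_le.1 (Nat.find_min hex (by omega))
    have h2 : a * wordProd r ω n ≤ wordProd r ω (n + 1) := by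
      simpa using le_wordProd_add (ω := ω) ha0.le ha n 1
    rw [hn] at hpos
    calc ρ ≤ D * wordProd r ω n := h1.le
      _ = D / a * (a * wordProd r ω n) := by field_simp
      _ ≤ max 1 (D / a) * wordProd r ω (n + 1) := by
        have := h.wordProd_pos ω n
        have := h.diam_pos
        gcongr
        exact le_max_right _ _

theorem continuous [Finite ι] (h : IsSeparatedCoding r π D δ) [TopologicalSpace ι]
    [DiscreteTopology ι] : Continuous π := by
  rw [continuous_iff_continuousAt]
  intro ω
  rw [ContinuousAt, tendsto_iff_dist_tendsto_zero, Metric.tendsto_nhds]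
  intro ε hε
  have hl : Tendsto (fun n => D * wordProd r ω n) atTop (𝓝 0) := by
    simpa using (tendsto_wordProd_zero (ω := ω) h.ratio_pos h.ratio_lt_one).const_mul D
  obtain ⟨n, hn⟩ := (hl.eventually_lt_const hε).exists
  filter_upwards [(PiNat.isOpen_cylinder (fun _ => ι) ω n).mem_nhds
    (PiNat.self_mem_cylinder ω n)] with ω' hω'
  simpa using (h.dist_le ω ω' n hω').trans_lt hn

section Measure

variable [Fintype ι] [MeasurableSpace ι] [DiscreteMeasurableSpace ι] [MeasurableSpace E]
  [BorelSpace E]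

theorem measurable (h : IsSeparatedCoding r π D δ) : Measurable π := by
  let _ : TopologicalSpace ι := ⊥
  have _ : DiscreteTopology ι := ⟨rfl⟩
  exact h.continuous.measurable

/-- Doubling property: the mass of a ball of radius comparable to the size of a cylinder at its
centre is comparable to the mass of the cylinder. -/
theorem exists_measure_closedBall_comparable (h : IsSeparatedCoding r π D δ)
    (w : stdSimplex ℝ ι) (hw : ∀ i, 0 < w.1 i) (C : ℝ) :
    ∃ C' : ℝ, 1 ≤ C' ∧ ∀ ω n ρ, D * wordProd r ω n ≤ ρ → ρ ≤ C * wordProd r ω n →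
      ENNReal.ofReal (wordProd w.1 ω n) ≤
        (bernoulliMeasure w).map π (Metric.closedBall (π ω) ρ) ∧
      (bernoulliMeasure w).map π (Metric.closedBall (π ω) ρ) ≤
        ENNReal.ofReal (C' * wordProd w.1 ω n) := by
  obtain ⟨k, hk⟩ := h.exists_preimage_closedBall_subset C
  obtain ⟨a, ha0, ha1, ha⟩ : ∃ a : ℝ, 0 < a ∧ a ≤ 1 ∧ ∀ i, a ≤ w.1 i := by
    cases isEmpty_or_nonempty ι
    · exact ⟨1, one_pos, le_rfl, fun i => isEmptyElim i⟩
    · obtain ⟨i, hi⟩ := Finite.exists_min w.1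
      refine ⟨w.1 i, hw i, ?_, hi⟩
      rw [← w.2.2]
      exact Finset.single_le_sum (fun j _ => w.2.1 j) (Finset.mem_univ i)
  refine ⟨(a ^ k)⁻¹, (one_le_inv₀ (by positivity)).2 (pow_le_one₀ ha0.le ha1),
    fun ω n ρ h1 h2 => ?_⟩
  rw [Measure.map_apply h.measurable Metric.isClosed_closedBall.measurableSet,
    ← bernoulliMeasure_cylinder]
  refine ⟨measure_mono (h.cylinder_subset_preimage_closedBall h1),
    (measure_mono (hk ω n ρ h2)).trans ?_⟩
  rw [bernoulliMeasure_cylinder]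
  refine ENNReal.ofReal_le_ofReal ?_
  have h3 := le_wordProd_add (ω := ω) ha0.le ha (n - k) (n - (n - k))
  rw [Nat.add_sub_cancel' (Nat.sub_le n k)] at h3
  have h4 : a ^ k ≤ a ^ (n - (n - k)) := pow_le_pow_of_le_one ha0.le ha1 (by omega)
  have h5 := _root_.wordProd_pos (ω := ω) hw (n - k)
  rw [le_inv_mul_iff₀ (by positivity)]
  exact le_trans (by gcongr) h3

/-- Along words, local dimensions can be computed with cylinders instead of balls. -/
theorem hasLocalDim_iff (h : IsSeparatedCoding r π D δ) (w : stdSimplex ℝ ι)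
    (hw : ∀ i, 0 < w.1 i) (ω : ℕ → ι) (α : ℝ) :
    HasLocalDim ((bernoulliMeasure w).map π) (π ω) α ↔
      Tendsto (fun n => Real.log (wordProd w.1 ω n) / Real.log (wordProd r ω n)) atTop (𝓝 α) := by
  set m := (bernoulliMeasure w).map π with hm
  have hprob : IsProbabilityMeasure m := Measure.isProbabilityMeasure_map h.measurable.aemeasurable
  obtain ⟨C, hC1, hC⟩ := h.exists_wordProd_comparable
  obtain ⟨C', hC'1, hC'⟩ := h.exists_measure_closedBall_comparable w hw (max C D)
  have hposw : ∀ n, 0 < wordProd w.1 ω n := _root_.wordProd_pos hw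
  have hposr := h.wordProd_pos ω
  have hD := h.diam_pos
  -- comparison of logarithms at comparable scales
  have hmeas : ∀ n ρ, D * wordProd r ω n ≤ ρ → ρ ≤ max C D * wordProd r ω n →
      m (Metric.closedBall (π ω) ρ) ≠ 0 ∧
      |Real.log (m (Metric.closedBall (π ω) ρ)).toReal - Real.log (wordProd w.1 ω n)| ≤
        Real.log C' := by
    intro n ρ h1 h2
    obtain ⟨h3, h4⟩ := hC' ω n ρ h1 h2
    have hne : m (Metric.closedBall (π ω) ρ) ≠ 0 := fun h0 => by
      rw [← hm, h0, nonpos_iff_eq_zero, ENNReal.ofReal_eq_zero] at h3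
      exact absurd (hposw n) (not_lt.2 h3)
    have h5 : wordProd w.1 ω n ≤ (m (Metric.closedBall (π ω) ρ)).toReal :=
      (ENNReal.ofReal_le_iff_le_toReal (measure_ne_top _ _)).1 h3
    have h6 : (m (Metric.closedBall (π ω) ρ)).toReal ≤ C' * wordProd w.1 ω n :=
      ENNReal.toReal_le_of_le_ofReal (mul_nonneg (by linarith) (hposw n).le) h4
    have hpos := (hposw n).trans_le h5
    exact ⟨hne, abs_log_sub_log_le hpos (hposw n) hC'1 h6 (by nlinarith)⟩
  have hscale : ∀ n ρ, 0 < ρ → D * wordProd r ω n ≤ ρ → ρ ≤ max C D * wordProd r ω n →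
      |Real.log ρ - Real.log (wordProd r ω n)| ≤ Real.log (max (max C D) D⁻¹) := by
    intro n ρ h0 h1 h2
    have hp := hposr n
    refine abs_log_sub_log_le h0 hp (hC1.trans ((le_max_left _ _).trans (le_max_left _ _)))
      (h2.trans (mul_le_mul_of_nonneg_right (le_max_left _ _) hp.le)) ?_
    calc _ = D⁻¹ * (D * wordProd r ω n) := by field_simp
      _ ≤ max (max C D) D⁻¹ * ρ :=
        mul_le_mul (le_max_right _ _) h1 (mul_pos hD hp).le
          ((inv_pos.2 hD).le.trans (le_max_right _ _))
  have hlogr : Tendsto (fun n => Real.log (wordProd r ω n)) atTop atBot :=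
    Real.tendsto_log_nhdsGT_zero.comp (tendsto_nhdsWithin_iff.2
      ⟨tendsto_wordProd_zero h.ratio_pos h.ratio_lt_one, Eventually.of_forall hposr⟩)
  set K := max (Real.log C') (Real.log (max (max C D) D⁻¹)) with hK
  constructor
  · intro H
    have hin : Tendsto (fun n => D * wordProd r ω n) atTop (𝓝[>] 0) := by
      refine tendsto_nhdsWithin_iff.2 ⟨?_, Eventually.of_forall fun n => mul_pos hD (hposr n)⟩
      simpa using (tendsto_wordProd_zero (ω := ω) h.ratio_pos h.ratio_lt_one).const_mul D
    have hb : ∀ n, D * wordProd r ω n ≤ max C D * wordProd r ω n := fun n => by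
      have := hposr n
      gcongr
      exact le_max_right _ _
    have H' := H.comp hin
    simp only [Function.comp_def,
      ennrealLog_div_log_eq (hmeas _ _ le_rfl (hb _)).1 (measure_ne_top _ _),
      EReal.tendsto_coe] at H'
    refine tendsto_div_of_bounded_perturbation (C := K) (Eventually.of_forall fun n => ?_)
      (Eventually.of_forall fun n => ?_) (Real.tendsto_log_nhdsGT_zero.comp hin) H'
    · rw [abs_sub_comm]
      exact (hmeas n _ le_rfl (hb n)).2.trans (le_max_left _ _)
    · rw [abs_sub_comm]
      exact (hscale n _ (mul_pos hD (hposr n)) le_rfl (hb n)).trans (le_max_right _ _)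
  · intro H
    have hex : ∀ ρ : ℝ, ∃ n, 0 < ρ → ρ ≤ 1 →
        D * wordProd r ω n ≤ ρ ∧ ρ ≤ max C D * wordProd r ω n := fun ρ => by
      by_cases hρ : 0 < ρ ∧ ρ ≤ 1
      · obtain ⟨n, h1, h2⟩ := hC ω ρ hρ.1 hρ.2
        refine ⟨n, fun _ _ => ⟨h1, h2.trans ?_⟩⟩
        have := hposr n
        gcongr
        exact le_max_left _ _
      · exact ⟨0, fun h1 h2 => absurd ⟨h1, h2⟩ hρ⟩
    choose n hn using hex
    have hev : ∀ᶠ ρ : ℝ in 𝓝[>] 0, 0 < ρ ∧ ρ ≤ 1 := by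
      filter_upwards [Ioc_mem_nhdsGT (zero_lt_one' ℝ)] with ρ hρ using hρ
    have hntop : Tendsto n (𝓝[>] 0) atTop := by
      refine tendsto_atTop.2 fun N => ?_
      filter_upwards [hev, Ioo_mem_nhdsGT (mul_pos hD (hposr N))] with ρ hρ hρN
      by_contra hlt
      have h1 := (hn ρ hρ.1 hρ.2).1
      have h2 := (h.strictAnti_wordProd ω).antitone (not_le.1 hlt).le
      have h3 : D * wordProd r ω N ≤ D * wordProd r ω (n ρ) := by gcongr
      linarith [hρN.2]
    have hlim : Tendsto (fun ρ : ℝ => Real.log (m (Metric.closedBall (π ω) ρ)).toReal /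
        Real.log ρ) (𝓝[>] 0) (𝓝 α) := by
      refine tendsto_div_of_bounded_perturbation (C := K) ?_ ?_ (hlogr.comp hntop)
        (H.comp hntop)
      · filter_upwards [hev] with ρ hρ
        obtain ⟨h1, h2⟩ := hn ρ hρ.1 hρ.2
        exact (hmeas _ _ h1 h2).2.trans (le_max_left _ _)
      · filter_upwards [hev] with ρ hρ
        obtain ⟨h1, h2⟩ := hn ρ hρ.1 hρ.2
        exact (hscale _ _ hρ.1 h1 h2).trans (le_max_right _ _)
    refine (EReal.tendsto_coe.2 hlim).congr' ?_
    filter_upwards [hev] with ρ hρ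
    obtain ⟨h1, h2⟩ := hn ρ hρ.1 hρ.2
    exact (ennrealLog_div_log_eq (hmeas _ _ h1 h2).1 (measure_ne_top _ _) ρ).symm

/-- A Bernoulli measure with positive weights is carried to a measure of full support. -/
theorem support_map_bernoulliMeasure (h : IsSeparatedCoding r π D δ) (w : stdSimplex ℝ ι)
    (hw : ∀ i, 0 < w.1 i) : ((bernoulliMeasure w).map π).support = range π := by
  refine Subset.antisymm (Measure.support_subset_of_isClosed h.isCompact_range.isClosed ?_) ?_
  · rw [mem_ae_iff, Measure.map_apply h.measurable h.isCompact_range.isClosed.measurableSet.compl]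
    simp
  · rintro _ ⟨ω, rfl⟩
    rw [Measure.mem_support_iff_forall]
    intro U hU
    obtain ⟨ε, hε, hεU⟩ := Metric.nhds_basis_closedBall.mem_iff.1 hU
    have hl : Tendsto (fun n => D * wordProd r ω n) atTop (𝓝 0) := by
      simpa using (tendsto_wordProd_zero (ω := ω) h.ratio_pos h.ratio_lt_one).const_mul D
    obtain ⟨n, hn⟩ := (hl.eventually_lt_const hε).exists
    refine lt_of_lt_of_le ?_ (measure_mono hεU)
    rw [Measure.map_apply h.measurable Metric.isClosed_closedBall.measurableSet]
    refine lt_of_lt_of_le ?_ (measure_mono (h.cylinder_subset_preimage_closedBall hn.le))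
    rw [bernoulliMeasure_cylinder]
    exact ENNReal.ofReal_pos.2 (_root_.wordProd_pos hw n)

end Measure

end IsSeparatedCoding

/-! ### The `L^q`-spectrum -/

theorem wordProd_rpow_mul_rpow {ι : Type*} {p r v : ι → ℝ} {q β : ℝ} (hp : ∀ i, 0 < p i)
    (hr : ∀ i, 0 < r i) (hv : ∀ i, v i = p i ^ q * r i ^ (-β)) (ω : ℕ → ι) (n : ℕ) :
    wordProd v ω n = wordProd p ω n ^ q * wordProd r ω n ^ (-β) := by
  simp only [wordProd, hv, Finset.prod_mul_distrib]
  rw [Real.finsetProd_rpow _ _ fun _ _ => (hp _).le,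
    Real.finsetProd_rpow _ _ fun _ _ => (hr _).le]

/-- For every `q` the pressure equation `∑ i, p i ^ q * r i ^ (-β) = 1` has a solution `β`. -/
theorem exists_pressure_root {ι : Type*} [Fintype ι] [Nonempty ι] {p r : ι → ℝ}
    (hp : ∀ i, 0 < p i) (hr0 : ∀ i, 0 < r i) (hr1 : ∀ i, r i < 1) (q : ℝ) :
    ∃ β : ℝ, ∑ i, p i ^ q * r i ^ (-β) = 1 := by
  have hcont : Continuous fun β : ℝ => ∑ i, p i ^ q * r i ^ (-β) := by
    refine continuous_finsetSum _ fun i _ => continuous_const.mul ?_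
    exact (Real.continuous_const_rpow (hr0 i).ne').comp continuous_neg
  have hbot : Tendsto (fun β : ℝ => ∑ i, p i ^ q * r i ^ (-β)) atBot (𝓝 0) := by
    have : ∀ i ∈ Finset.univ, Tendsto (fun β : ℝ => p i ^ q * r i ^ (-β)) atBot (𝓝 0) := by
      intro i _
      have := ((tendsto_rpow_atTop_of_base_lt_one (r i) (by linarith [hr0 i]) (hr1 i)).comp
        tendsto_neg_atBot_atTop).const_mul (p i ^ q)
      simpa using this
    simpa using tendsto_finsetSum _ this
  have htop : ∃ β : ℝ, 1 ≤ ∑ i, p i ^ q * r i ^ (-β) := by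
    obtain ⟨i⟩ := ‹Nonempty ι›
    have hb : Tendsto (fun β : ℝ => r i ^ (-β)) atTop atTop :=
      (tendsto_rpow_atBot_of_base_lt_one (r i) (hr0 i) (hr1 i)).comp
        tendsto_neg_atTop_atBot
    have hpq : 0 < p i ^ q := Real.rpow_pos_of_pos (hp i) q
    obtain ⟨β, hβ⟩ := ((hb.const_mul_atTop hpq).eventually_ge_atTop 1).exists
    refine ⟨β, hβ.trans ?_⟩
    exact Finset.single_le_sum (f := fun i => p i ^ q * r i ^ (-β))
      (fun j _ => mul_nonneg (Real.rpow_nonneg (hp j).le _) (Real.rpow_nonneg (hr0 j).le _))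
      (Finset.mem_univ i)
  obtain ⟨β₀, h0⟩ := (hbot.eventually_le_const one_pos).exists
  obtain ⟨β₁, h1⟩ := htop
  obtain ⟨β, hβ⟩ := intermediate_value_univ β₀ β₁ hcont ⟨h0, h1⟩
  exact ⟨β, hβ⟩

/-- A compact set contains a finite `ε`-separated subset which is an `ε`-cover. -/
theorem exists_finite_isSeparated_isCover {X : Type*} [MetricSpace X] {A : Set X}
    (hA : IsCompact A) {ε : ℝ≥0} (hε : ε ≠ 0) :
    ∃ N ⊆ A, N.Finite ∧ Metric.IsSeparated ε N ∧ Metric.IsCover ε A N := by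
  obtain ⟨N, -, hN, hcov⟩ := Metric.exists_finite_isCover_of_isCompact
    (ε := ε / 2) (by positivity) hA
  have htop : Metric.packingNumber ε A ≠ ⊤ := by
    have h1 := Metric.packingNumber_two_mul_le_externalCoveringNumber (ε / 2) A
    rw [mul_div_cancel₀ _ two_ne_zero] at h1
    exact ((h1.trans hcov.externalCoveringNumber_le_encard).trans_lt
      (encard_lt_top_iff.2 hN)).ne
  exact ⟨_, Metric.maximalSeparatedSet_subset,
    encard_lt_top_iff.1 (Metric.encard_maximalSeparatedSet htop ▸ htop.lt_top),
    Metric.isSeparated_maximalSeparatedSet, Metric.isCover_maximalSeparatedSet htop⟩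

namespace IsSeparatedCoding

variable {ι E : Type*} [MetricSpace E] {r : ι → ℝ} {π : (ℕ → ι) → E} {D δ : ℝ}
  [Fintype ι] [MeasurableSpace ι] [DiscreteMeasurableSpace ι] [MeasurableSpace E] [BorelSpace E]

/-- Gibbs property of the auxiliary measure `ν` with weights `v i = p i ^ q * r i ^ (-β)`: the mass
`ν (B (x, ρ))` is comparable to `μ (B (x, ρ)) ^ q * ρ ^ (-β)`. -/
theorem exists_gibbs_bound (h : IsSeparatedCoding r π D δ) {p v : stdSimplex ℝ ι} {q β : ℝ}
    (hp : ∀ i, 0 < p.1 i) (hv : ∀ i, v.1 i = p.1 i ^ q * r i ^ (-β)) :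
    ∃ C : ℝ, 1 ≤ C ∧ ∀ ω ρ, 0 < ρ → ρ ≤ 1 →
      (bernoulliMeasure p).map π (Metric.closedBall (π ω) ρ) ^ q ≤ ENNReal.ofReal (C * ρ ^ β) *
        (bernoulliMeasure v).map π (Metric.closedBall (π ω) ρ) ∧
      (bernoulliMeasure v).map π (Metric.closedBall (π ω) (2 * ρ)) ≤
        ENNReal.ofReal (C * ρ ^ (-β)) *
          (bernoulliMeasure p).map π (Metric.closedBall (π ω) ρ) ^ q := by
  have hv0 : ∀ i, 0 < v.1 i := fun i => by
    rw [hv]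
    exact mul_pos (Real.rpow_pos_of_pos (hp i) _) (Real.rpow_pos_of_pos (h.ratio_pos i) _)
  have hprob : ∀ w : stdSimplex ℝ ι, IsProbabilityMeasure ((bernoulliMeasure w).map π) :=
    fun w => Measure.isProbabilityMeasure_map h.measurable.aemeasurable
  obtain ⟨C₀, hC₀1, hC₀⟩ := h.exists_wordProd_comparable
  obtain ⟨C₁, hC₁1, hC₁⟩ := h.exists_measure_closedBall_comparable p hp C₀
  obtain ⟨C₂, hC₂1, hC₂⟩ := h.exists_measure_closedBall_comparable v hv0 (2 * C₀)
  have hD := h.diam_pos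
  set K := max C₀ D⁻¹ with hK
  have hK1 : 1 ≤ K := hC₀1.trans (le_max_left _ _)
  have hA : 1 ≤ C₁ ^ |q| := Real.one_le_rpow hC₁1 (abs_nonneg _)
  have hB : 1 ≤ K ^ |β| := Real.one_le_rpow hK1 (abs_nonneg _)
  have hAB : 1 ≤ C₁ ^ |q| * K ^ |β| := one_le_mul_of_one_le_of_one_le hA hB
  refine ⟨C₁ ^ |q| * K ^ |β| * C₂, one_le_mul_of_one_le_of_one_le hAB hC₂1,
    fun ω ρ hρ0 hρ1 => ?_⟩
  obtain ⟨n, hn1, hn2⟩ := hC₀ ω ρ hρ0 hρ1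
  have hR := h.wordProd_pos ω n
  have hP : 0 < wordProd p.1 ω n := _root_.wordProd_pos hp n
  have hV : 0 < wordProd v.1 ω n := _root_.wordProd_pos hv0 n
  have hVeq := wordProd_rpow_mul_rpow hp h.ratio_pos hv ω n
  obtain ⟨hm1, hm2⟩ := hC₁ ω n ρ hn1 hn2
  obtain ⟨hn3, -⟩ := hC₂ ω n ρ hn1 (by nlinarith)
  obtain ⟨-, hn4⟩ := hC₂ ω n (2 * ρ) (by linarith) (by linarith)
  set M := ((bernoulliMeasure p).map π (Metric.closedBall (π ω) ρ)).toReal with hM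
  have hMeq : (bernoulliMeasure p).map π (Metric.closedBall (π ω) ρ) = ENNReal.ofReal M :=
    (ENNReal.ofReal_toReal (measure_ne_top _ _)).symm
  have hPM : wordProd p.1 ω n ≤ M :=
    (ENNReal.ofReal_le_iff_le_toReal (measure_ne_top _ _)).1 hm1
  have hMP : M ≤ C₁ * wordProd p.1 ω n :=
    ENNReal.toReal_le_of_le_ofReal (mul_nonneg (by linarith) hP.le) hm2
  have hM0 : 0 < M := hP.trans_le hPM
  have hRρ : wordProd r ω n ≤ K * ρ := by
    calc _ = D⁻¹ * (D * wordProd r ω n) := by field_simp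
      _ ≤ K * ρ := mul_le_mul (le_max_right _ _) hn1 (mul_pos hD hR).le (by linarith)
  have hρR : ρ ≤ K * wordProd r ω n :=
    hn2.trans (mul_le_mul_of_nonneg_right (le_max_left _ _) hR.le)
  have e1 : M ^ q ≤ C₁ ^ |q| * wordProd p.1 ω n ^ q :=
    rpow_le_mul_rpow_of_comparable hM0 hP hC₁1 hMP (by nlinarith) q
  have e2 : wordProd p.1 ω n ^ q ≤ C₁ ^ |q| * M ^ q :=
    rpow_le_mul_rpow_of_comparable hP hM0 hC₁1 (by nlinarith) hMP q
  have e3 : wordProd r ω n ^ β ≤ K ^ |β| * ρ ^ β :=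
    rpow_le_mul_rpow_of_comparable hR hρ0 hK1 hRρ hρR β
  have e4 : wordProd r ω n ^ (-β) ≤ K ^ |β| * ρ ^ (-β) := by
    simpa using rpow_le_mul_rpow_of_comparable hR hρ0 hK1 hRρ hρR (-β)
  have hPq : 0 < wordProd p.1 ω n ^ q := Real.rpow_pos_of_pos hP q
  have hMq : 0 < M ^ q := Real.rpow_pos_of_pos hM0 q
  have hρβ : 0 < ρ ^ β := Real.rpow_pos_of_pos hρ0 β
  have hρβ' : 0 < ρ ^ (-β) := Real.rpow_pos_of_pos hρ0 (-β)
  rw [hMeq, ENNReal.ofReal_rpow_of_pos hM0]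
  constructor
  · refine le_trans ?_ (mul_le_mul_right hn3 _)
    rw [← ENNReal.ofReal_mul (by positivity)]
    refine ENNReal.ofReal_le_ofReal ?_
    have hPV : wordProd p.1 ω n ^ q = wordProd v.1 ω n * wordProd r ω n ^ β := by
      rw [hVeq, mul_assoc, ← Real.rpow_add hR, neg_add_cancel, Real.rpow_zero, mul_one]
    calc M ^ q ≤ C₁ ^ |q| * (wordProd v.1 ω n * wordProd r ω n ^ β) := hPV ▸ e1
      _ ≤ C₁ ^ |q| * (wordProd v.1 ω n * (K ^ |β| * ρ ^ β)) := by gcongr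
      _ = 1 * (C₁ ^ |q| * K ^ |β| * ρ ^ β * wordProd v.1 ω n) := by ring
      _ ≤ C₂ * (C₁ ^ |q| * K ^ |β| * ρ ^ β * wordProd v.1 ω n) := by gcongr
      _ = _ := by ring
  · refine hn4.trans ?_
    rw [← ENNReal.ofReal_mul (by positivity)]
    refine ENNReal.ofReal_le_ofReal ?_
    calc _ = C₂ * (wordProd p.1 ω n ^ q * wordProd r ω n ^ (-β)) := by rw [hVeq]
      _ ≤ C₂ * ((C₁ ^ |q| * M ^ q) * (K ^ |β| * ρ ^ (-β))) := by gcongr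
      _ = _ := by ring

theorem exists_packingMoment_bounds (h : IsSeparatedCoding r π D δ) {p v : stdSimplex ℝ ι}
    {q β : ℝ} (hp : ∀ i, 0 < p.1 i) (hv : ∀ i, v.1 i = p.1 i ^ q * r i ^ (-β)) :
    ∃ C : ℝ, 1 ≤ C ∧ ∀ ρ, 0 < ρ → ρ ≤ 1 →
      packingMoment ((bernoulliMeasure p).map π) ρ q ≤ ENNReal.ofReal (C * ρ ^ β) ∧
      1 ≤ ENNReal.ofReal (C * ρ ^ (-β)) * packingMoment ((bernoulliMeasure p).map π) ρ q := by
  obtain ⟨C, hC1, hC⟩ := h.exists_gibbs_bound hp hv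
  have hprob : IsProbabilityMeasure ((bernoulliMeasure v).map π) :=
    Measure.isProbabilityMeasure_map h.measurable.aemeasurable
  have hsupp := h.support_map_bernoulliMeasure p hp
  refine ⟨C, hC1, fun ρ hρ0 hρ1 => ⟨?_, ?_⟩⟩
  · refine iSup_le fun s => iSup_le fun hs => iSup_le fun hsep => ?_
    rw [hsupp] at hs
    have hdisj : Pairwise (Function.onFun Disjoint fun x : s => Metric.closedBall (x : E) ρ) := by
      intro x y hxy
      refine Metric.closedBall_disjoint_closedBall ?_
      have : ENNReal.ofReal (2 * ρ) < edist (x : E) y :=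
        hsep x.2 y.2 (Subtype.coe_injective.ne hxy)
      rw [edist_dist, ENNReal.ofReal_lt_ofReal_iff_of_nonneg (by linarith)] at this
      linarith
    calc ∑' x : s, (bernoulliMeasure p).map π (Metric.closedBall (x : E) ρ) ^ q
        ≤ ∑' x : s, ENNReal.ofReal (C * ρ ^ β) *
            (bernoulliMeasure v).map π (Metric.closedBall (x : E) ρ) := by
          refine ENNReal.tsum_le_tsum fun x => ?_
          obtain ⟨ω, hω⟩ := hs x.2
          rw [← hω]
          exact (hC ω ρ hρ0 hρ1).1
      _ = ENNReal.ofReal (C * ρ ^ β) *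
            ∑' x : s, (bernoulliMeasure v).map π (Metric.closedBall (x : E) ρ) :=
          ENNReal.tsum_mul_left
      _ ≤ ENNReal.ofReal (C * ρ ^ β) * 1 := by
          gcongr
          exact (tsum_meas_le_meas_iUnion_of_disjoint _
            (fun _ => Metric.isClosed_closedBall.measurableSet) hdisj).trans prob_le_one
      _ = _ := mul_one _
  · obtain ⟨N, hNs, hNf, hNsep, hNcov⟩ := exists_finite_isSeparated_isCover h.isCompact_range
      (ε := (2 * ρ).toNNReal) (by simpa using hρ0)
    have hone : (bernoulliMeasure v).map π (range π) = 1 := by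
      rw [Measure.map_apply h.measurable h.isCompact_range.isClosed.measurableSet]
      simp
    have hcov := hNcov.subset_iUnion_closedBall
    rw [Real.coe_toNNReal _ (by linarith)] at hcov
    calc 1 ≤ (bernoulliMeasure v).map π (⋃ x ∈ N, Metric.closedBall x (2 * ρ)) :=
          hone ▸ measure_mono hcov
      _ ≤ ∑' x : N, (bernoulliMeasure v).map π (Metric.closedBall (x : E) (2 * ρ)) :=
          measure_biUnion_le _ hNf.countable _
      _ ≤ ∑' x : N, ENNReal.ofReal (C * ρ ^ (-β)) *
            (bernoulliMeasure p).map π (Metric.closedBall (x : E) ρ) ^ q := by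
          refine ENNReal.tsum_le_tsum fun x => ?_
          obtain ⟨ω, hω⟩ := hNs x.2
          rw [← hω]
          exact (hC ω ρ hρ0 hρ1).2
      _ = ENNReal.ofReal (C * ρ ^ (-β)) *
            ∑' x : N, (bernoulliMeasure p).map π (Metric.closedBall (x : E) ρ) ^ q :=
          ENNReal.tsum_mul_left
      _ ≤ _ := by
          gcongr
          exact le_iSup_of_le N (le_iSup_of_le (hsupp ▸ hNs) (le_iSup_of_le hNsep le_rfl))

/-- The `L^q`-spectrum is the solution of the pressure equation. -/
theorem lqSpectrum_eq (h : IsSeparatedCoding r π D δ) {p : stdSimplex ℝ ι} {q β : ℝ}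
    (hp : ∀ i, 0 < p.1 i) (hβ : ∑ i, p.1 i ^ q * r i ^ (-β) = 1) :
    lqSpectrum ((bernoulliMeasure p).map π) q = (β : EReal) := by
  let v : stdSimplex ℝ ι := ⟨fun i => p.1 i ^ q * r i ^ (-β), fun i =>
    mul_nonneg (Real.rpow_nonneg (hp i).le _) (Real.rpow_nonneg (h.ratio_pos i).le _), hβ⟩
  obtain ⟨C, hC1, hC⟩ := h.exists_packingMoment_bounds (v := v) hp fun i => rfl
  set G := packingMoment ((bernoulliMeasure p).map π) with hG
  have hev : ∀ᶠ ρ : ℝ in 𝓝[>] 0, 0 < ρ ∧ ρ < 1 := by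
    filter_upwards [Ioo_mem_nhdsGT (zero_lt_one' ℝ)] with ρ hρ using hρ
  have hfin : ∀ ρ, 0 < ρ → ρ ≤ 1 → G ρ q ≠ 0 ∧ G ρ q ≠ ⊤ := fun ρ h0 h1 => by
    obtain ⟨h2, h3⟩ := hC ρ h0 h1
    exact ⟨fun hz => by simp [hz] at h3, (h2.trans_lt ENNReal.ofReal_lt_top).ne⟩
  have hlim : Tendsto (fun ρ : ℝ => Real.log (G ρ q).toReal / Real.log ρ) (𝓝[>] 0) (𝓝 β) := by
    refine tendsto_div_of_bounded_perturbation (a := fun ρ => β * Real.log ρ) (b := Real.log)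
      (C := Real.log C) ?_ ?_ Real.tendsto_log_nhdsGT_zero ?_
    · filter_upwards [hev] with ρ hρ
      obtain ⟨h2, h3⟩ := hC ρ hρ.1 hρ.2.le
      obtain ⟨h4, h5⟩ := hfin ρ hρ.1 hρ.2.le
      have hρβ : 0 < ρ ^ β := Real.rpow_pos_of_pos hρ.1 β
      have hρβ' : 0 < ρ ^ (-β) := Real.rpow_pos_of_pos hρ.1 (-β)
      have hg : 0 < (G ρ q).toReal := ENNReal.toReal_pos h4 h5
      have h6 : (G ρ q).toReal ≤ C * ρ ^ β :=
        ENNReal.toReal_le_of_le_ofReal (by positivity) h2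
      have h7 : 1 ≤ C * ρ ^ (-β) * (G ρ q).toReal := by
        rw [← ENNReal.ofReal_toReal h5, ← ENNReal.ofReal_mul (by positivity)] at h3
        exact ENNReal.one_le_ofReal.1 h3
      have h8 : ρ ^ β ≤ C * (G ρ q).toReal := by
        calc ρ ^ β = ρ ^ β * 1 := (mul_one _).symm
          _ ≤ ρ ^ β * (C * ρ ^ (-β) * (G ρ q).toReal) := by gcongr
          _ = (ρ ^ β * ρ ^ (-β)) * (C * (G ρ q).toReal) := by ring
          _ = _ := by rw [← Real.rpow_add hρ.1, add_neg_cancel, Real.rpow_zero, one_mul]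
      rw [← Real.log_rpow hρ.1]
      exact abs_log_sub_log_le hg hρβ hC1 h6 h8
    · exact Eventually.of_forall fun ρ => by simpa using Real.log_nonneg hC1
    · refine tendsto_const_nhds.congr' ?_
      filter_upwards [hev] with ρ hρ
      rw [mul_div_assoc, div_self (Real.log_neg hρ.1 hρ.2).ne, mul_one]
  refine Tendsto.liminf_eq ((EReal.tendsto_coe.2 hlim).congr' ?_)
  filter_upwards [hev] with ρ hρ
  obtain ⟨h4, h5⟩ := hfin ρ hρ.1 hρ.2.le
  exact (ennrealLog_div_log_eq h4 h5 ρ).symm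

end IsSeparatedCoding

/-! ### Dimension bounds -/

namespace IsSeparatedCoding

variable {ι E : Type*} [MetricSpace E] {r : ι → ℝ} {π : (ℕ → ι) → E} {D δ : ℝ}
  [Fintype ι]

/-- If the Bernoulli weight of the `n`-th cylinder around each `ω ∈ A` is at least the size of that
cylinder to the power `t`, for all large `n`, then `π '' A` has dimension at most `t`: the
cylinders of generation `n` that meet `A` are covers of bounded `t`-dimensional cost. -/
theorem dimH_image_le (h : IsSeparatedCoding r π D δ) (v : stdSimplex ℝ ι) {t : ℝ≥0} (ht : 0 < t)
    {N : ℕ} {A : Set (ℕ → ι)}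
    (hA : ∀ ω ∈ A, ∀ n, N ≤ n → wordProd r ω n ^ (t : ℝ) ≤ wordProd v.1 ω n) :
    dimH (π '' A) ≤ t := by
  borelize E
  obtain ⟨a, b, -, -, hb0, hb1, -, hb⟩ := exists_weight_bounds h.ratio_pos h.ratio_lt_one
  have hD := h.diam_pos
  let T : ∀ n : ℕ, (Fin n → ι) → Set E := fun n u => π '' {ω ∈ A | ∀ k : Fin n, ω k = u k}
  have hdiam : ∀ n u, ∀ ω ∈ {ω ∈ A | ∀ k : Fin n, ω k = u k},
      Metric.ediam (T n u) ≤ ENNReal.ofReal (D * wordProd r ω n) := by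
    rintro n u ω ⟨-, hω⟩
    refine Metric.ediam_le ?_
    rintro _ ⟨ω₁, ⟨-, h1⟩, rfl⟩ _ ⟨ω₂, ⟨-, h2⟩, rfl⟩
    have hcyl : ∀ η : ℕ → ι, (∀ k : Fin n, η k = u k) → ω₂ ∈ PiNat.cylinder η n :=
      fun η hη => PiNat.mem_cylinder_iff.2 fun i hi => (h2 ⟨i, hi⟩).trans (hη ⟨i, hi⟩).symm
    rw [edist_dist]
    refine ENNReal.ofReal_le_ofReal ?_
    rw [← wordProd_congr (hcyl ω hω), dist_comm, wordProd_congr (hcyl ω₁ h1)]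
    exact h.dist_le _ _ n (hcyl ω₁ h1)
  have hprod : ∀ n (u : Fin n → ι) ω, (∀ k : Fin n, ω k = u k) →
      wordProd v.1 ω n = ∏ k, v.1 (u k) := fun n u ω hω => by
    rw [wordProd, Finset.prod_range]
    exact Finset.prod_congr rfl fun k _ => by rw [hω]
  have hterm : ∀ n, N ≤ n → ∀ u, Metric.ediam (T n u) ^ (t : ℝ) ≤
      ENNReal.ofReal (D ^ (t : ℝ) * ∏ k, v.1 (u k)) := by
    intro n hn u
    rcases Set.eq_empty_or_nonempty {ω ∈ A | ∀ k : Fin n, ω k = u k} with he | ⟨ω, hω⟩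
    · simp [T, he, ht]
    · have hR := h.wordProd_pos ω n
      calc _ ≤ ENNReal.ofReal (D * wordProd r ω n) ^ (t : ℝ) := by
            gcongr
            exact hdiam n u ω hω
        _ = ENNReal.ofReal (D ^ (t : ℝ) * wordProd r ω n ^ (t : ℝ)) := by
            rw [ENNReal.ofReal_rpow_of_pos (mul_pos hD hR), Real.mul_rpow hD.le hR.le]
        _ ≤ _ := by
            rw [← hprod n u ω hω.2]
            have := hA ω hω.1 n hn
            gcongr
  have hsum : ∀ n, ∑ u : Fin n → ι, ∏ k, v.1 (u k) = 1 := fun n => by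
    have := v.2.2
    rw [← Fintype.sum_pow, this, one_pow]
  refine dimH_le_of_hausdorffMeasure_ne_top (ne_top_of_le_ne_top
    (ENNReal.ofReal_ne_top (r := D ^ (t : ℝ))) ?_)
  have hlim : Tendsto (fun n : ℕ => ENNReal.ofReal (D * b ^ n)) atTop (𝓝 0) := by
    have := (tendsto_pow_atTop_nhds_zero_of_lt_one hb0.le hb1).const_mul D
    simpa using ENNReal.tendsto_ofReal this
  refine (Measure.hausdorffMeasure_le_liminf_sum (t : ℝ) (π '' A) (l := atTop) _ hlim T
    (Eventually.of_forall fun n u => ?_) (Eventually.of_forall fun n => ?_)).trans ?_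
  · rcases Set.eq_empty_or_nonempty {ω ∈ A | ∀ k : Fin n, ω k = u k} with he | ⟨ω, hω⟩
    · simp [T, he]
    · refine (hdiam n u ω hω).trans (ENNReal.ofReal_le_ofReal ?_)
      have := wordProd_add_le (ω := ω) (fun i => (h.ratio_pos i).le) hb 0 n
      simp only [zero_add, wordProd_zero, mul_one] at this
      gcongr
  · rintro _ ⟨ω, hω, rfl⟩
    exact mem_iUnion.2 ⟨fun k => ω k, ω, ⟨hω, fun _ => rfl⟩, rfl⟩
  · refine liminf_le_of_frequently_le' (Eventually.frequently ?_)
    filter_upwards [eventually_ge_atTop N] with n hn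
    calc _ ≤ ∑ u : Fin n → ι, ENNReal.ofReal (D ^ (t : ℝ) * ∏ k, v.1 (u k)) :=
          Finset.sum_le_sum fun u _ => hterm n hn u
      _ = _ := by
          rw [← ENNReal.ofReal_sum_of_nonneg, ← Finset.mul_sum, hsum, mul_one]
          exact fun u _ => mul_nonneg (by positivity) (Finset.prod_nonneg fun _ _ => v.2.1 _)

theorem dimH_image_le_of_tendsto (h : IsSeparatedCoding r π D δ) {v : stdSimplex ℝ ι}
    (hv : ∀ i, 0 < v.1 i) {s : ℝ} (hs : 0 ≤ s) {A : Set (ℕ → ι)}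
    (hA : ∀ ω ∈ A, Tendsto (fun n => Real.log (wordProd v.1 ω n) / Real.log (wordProd r ω n))
      atTop (𝓝 s)) : dimH (π '' A) ≤ ENNReal.ofReal s := by
  refine ENNReal.le_of_forall_pos_le_add fun ε hε _ => ?_
  have ht : ENNReal.ofReal s + ε = ((s.toNNReal + ε : ℝ≥0) : ℝ≥0∞) := by
    rw [ENNReal.coe_add]; rfl
  rw [ht]
  set t : ℝ≥0 := s.toNNReal + ε with htdef
  have hst : s < (t : ℝ) := by
    rw [htdef, NNReal.coe_add, Real.coe_toNNReal _ hs]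
    exact lt_add_of_pos_right _ hε
  have hcov : π '' A ⊆ ⋃ N, π '' {ω | ∀ n, N ≤ n →
      wordProd r ω n ^ (t : ℝ) ≤ wordProd v.1 ω n} := by
    rintro _ ⟨ω, hω, rfl⟩
    obtain ⟨N, hN⟩ := eventually_atTop.1 (((hA ω hω).eventually_lt_const hst).and
      (eventually_ge_atTop 1))
    refine mem_iUnion.2 ⟨N, ω, fun n hn => ?_, rfl⟩
    obtain ⟨h1, h2⟩ := hN n hn
    have hR := h.wordProd_pos ω n
    have hR1 : wordProd r ω n < 1 := by
      simpa using h.strictAnti_wordProd ω (Nat.lt_of_lt_of_le Nat.zero_lt_one h2)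
    rw [div_lt_iff_of_neg (Real.log_neg hR hR1)] at h1
    rw [← Real.log_le_log_iff (Real.rpow_pos_of_pos hR _) (_root_.wordProd_pos hv n),
      Real.log_rpow hR]
    exact h1.le
  refine (dimH_mono hcov).trans ?_
  rw [dimH_iUnion]
  exact iSup_le fun N => h.dimH_image_le v (add_pos_of_nonneg_of_pos zero_le hε)
    fun ω hω n hn => hω n hn

variable [MeasurableSpace ι] [DiscreteMeasurableSpace ι]

/-- Mass distribution principle: if the Bernoulli weight of the `n`-th cylinder around each `ω ∈ A`
is at most the size of that cylinder to the power `t`, for all large `n`, and `A` has positive mass,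
then `π '' A` has dimension at least `t`. -/
theorem le_dimH_image (h : IsSeparatedCoding r π D δ) (w : stdSimplex ℝ ι) {t : ℝ≥0}
    (ht : 0 < t) {N : ℕ} {A : Set (ℕ → ι)}
    (hA : ∀ ω ∈ A, ∀ n, N ≤ n → wordProd w.1 ω n ≤ wordProd r ω n ^ (t : ℝ))
    (hpos : bernoulliMeasure w A ≠ 0) : (t : ℝ≥0∞) ≤ dimH (π '' A) := by
  borelize E
  obtain ⟨a, b, ha0, ha1, -, -, ha, -⟩ := exists_weight_bounds h.ratio_pos h.ratio_lt_one
  obtain ⟨C, hC1, hC⟩ := h.exists_wordProd_comparable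
  obtain ⟨k, hk⟩ := h.exists_preimage_closedBall_subset C
  have hD := h.diam_pos
  set m : Measure E := ((bernoulliMeasure w).restrict A).map π with hm
  set K : ℝ := (a ^ k)⁻¹ * D⁻¹ with hK
  have hK0 : 0 < K := by positivity
  -- below the scale `ε` the cylinders that are used have at least `N` letters
  set ε : ℝ := min 1 (D * a ^ (N + k)) with hε
  have hε0 : 0 < ε := by positivity
  have key : ∀ (U : Set E) (ρ : ℝ), 0 < ρ → ρ ≤ ε → Metric.ediam U ≤ ENNReal.ofReal ρ →
      m U ≤ ENNReal.ofReal (K * ρ) ^ (t : ℝ) := by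
    intro U ρ hρ0 hρε hU
    rw [← Metric.ediam_closure] at hU
    refine (measure_mono subset_closure).trans ?_
    rw [hm, Measure.map_apply h.measurable isClosed_closure.measurableSet,
      Measure.restrict_apply (h.measurable isClosed_closure.measurableSet)]
    rcases Set.eq_empty_or_nonempty (π ⁻¹' closure U ∩ A) with he | ⟨ω, hωU, hωA⟩
    · simp [he]
    obtain ⟨n, hn1, hn2⟩ := hC ω ρ hρ0 (hρε.trans (min_le_left _ _))
    have hsub : π ⁻¹' closure U ∩ A ⊆ PiNat.cylinder ω (n - k) := by
      refine inter_subset_left.trans (Subset.trans ?_ (hk ω n ρ hn2))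
      intro ω' hω'
      have h1 := (Metric.edist_le_ediam_of_mem (x := π ω') (y := π ω) hω' hωU).trans hU
      rw [edist_dist, ENNReal.ofReal_le_ofReal_iff hρ0.le] at h1
      exact h1
    have hnk : N + k ≤ n := by
      by_contra hlt
      have h1 := le_wordProd_add (ω := ω) ha0.le ha 0 (N + k)
      rw [wordProd_zero, mul_one, zero_add] at h1
      have h2 := h.strictAnti_wordProd ω (not_le.1 hlt)
      have h3 : D * a ^ (N + k) < D * wordProd r ω n :=
        mul_lt_mul_of_pos_left (h1.trans_lt h2) hD
      linarith [hρε.trans (min_le_right _ _)]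
    have hR := h.wordProd_pos ω (n - k)
    have hRρ : wordProd r ω (n - k) ≤ K * ρ := by
      have h1 := le_wordProd_add (ω := ω) ha0.le ha (n - k) k
      rw [Nat.sub_add_cancel (by omega)] at h1
      calc wordProd r ω (n - k) = (a ^ k)⁻¹ * (a ^ k * wordProd r ω (n - k)) := by field_simp
        _ ≤ (a ^ k)⁻¹ * wordProd r ω n := by gcongr
        _ = (a ^ k)⁻¹ * D⁻¹ * (D * wordProd r ω n) := by field_simp
        _ ≤ _ := by gcongr
    refine (measure_mono hsub).trans ?_
    rw [bernoulliMeasure_cylinder, ENNReal.ofReal_rpow_of_pos (by positivity)]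
    refine ENNReal.ofReal_le_ofReal ((hA ω hωA (n - k) (by omega)).trans ?_)
    exact Real.rpow_le_rpow hR.le hRρ t.coe_nonneg
  have key' : ∀ U : Set E, Metric.ediam U ≤ ENNReal.ofReal ε →
      m U ≤ ENNReal.ofReal K ^ (t : ℝ) * Metric.ediam U ^ (t : ℝ) := by
    intro U hU
    rw [← ENNReal.mul_rpow_of_nonneg _ _ t.coe_nonneg]
    rcases eq_or_ne (Metric.ediam U) 0 with h0 | h0
    · have hl : Tendsto (fun ρ : ℝ => ENNReal.ofReal (K * ρ) ^ (t : ℝ)) (𝓝[>] 0) (𝓝 0) := by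
        have hc : Continuous fun ρ : ℝ => ENNReal.ofReal (K * ρ) ^ (t : ℝ) :=
          ENNReal.continuous_rpow_const.comp
            (ENNReal.continuous_ofReal.comp (continuous_const_mul K))
        have := hc.tendsto 0
        simp only [mul_zero, ENNReal.ofReal_zero,
          ENNReal.zero_rpow_of_pos (NNReal.coe_pos.2 ht)] at this
        exact this.mono_left nhdsWithin_le_nhds
      refine le_trans (ge_of_tendsto hl ?_) zero_le
      filter_upwards [Ioc_mem_nhdsGT hε0] with ρ hρ
      exact key U ρ hρ.1 hρ.2 (h0 ▸ zero_le)
    · have htop : Metric.ediam U ≠ ⊤ := ne_top_of_le_ne_top ENNReal.ofReal_ne_top hU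
      have := key U (Metric.ediam U).toReal (ENNReal.toReal_pos h0 htop)
        (ENNReal.toReal_le_of_le_ofReal hε0.le hU) (ENNReal.ofReal_toReal htop).ge
      rwa [ENNReal.ofReal_mul hK0.le, ENNReal.ofReal_toReal htop] at this
  set c : ℝ≥0∞ := ENNReal.ofReal K ^ (t : ℝ) with hc
  have hc0 : c ≠ 0 := by
    rw [hc, ENNReal.ofReal_rpow_of_pos hK0]
    exact (ENNReal.ofReal_pos.2 (Real.rpow_pos_of_pos hK0 _)).ne'
  have hctop : c ≠ ⊤ := ENNReal.rpow_ne_top_of_nonneg t.coe_nonneg ENNReal.ofReal_ne_top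
  have hle : c⁻¹ • m ≤ Measure.hausdorffMeasure (t : ℝ) := by
    refine Measure.le_hausdorffMeasure _ _ _ (ENNReal.ofReal_pos.2 hε0) fun U hU => ?_
    rw [Measure.smul_apply, smul_eq_mul]
    calc c⁻¹ * m U ≤ c⁻¹ * (c * Metric.ediam U ^ (t : ℝ)) := by
          gcongr
          exact key' U hU
      _ = _ := by rw [← mul_assoc, ENNReal.inv_mul_cancel hc0 hctop, one_mul]
  refine le_dimH_of_hausdorffMeasure_ne_zero fun h0 => ?_
  have h1 := (hle (π '' A)).trans h0.le
  rw [Measure.smul_apply, smul_eq_mul, nonpos_iff_eq_zero, mul_eq_zero] at h1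
  rcases h1 with h1 | h1
  · exact hctop (ENNReal.inv_eq_zero.1 h1)
  · have h2 : (bernoulliMeasure w).restrict A A ≤ m (π '' A) :=
      (measure_mono (subset_preimage_image π A)).trans
        (Measure.le_map_apply h.measurable.aemeasurable _)
    rw [Measure.restrict_apply_self, h1] at h2
    exact hpos (nonpos_iff_eq_zero.1 h2)

theorem le_dimH_image_of_ae_tendsto (h : IsSeparatedCoding r π D δ) {w : stdSimplex ℝ ι}
    {s : ℝ} {A : Set (ℕ → ι)} (hA : ∀ᵐ ω ∂(bernoulliMeasure w), ω ∈ A ∧ Tendsto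
      (fun n => Real.log (wordProd w.1 ω n) / Real.log (wordProd r ω n)) atTop (𝓝 s))
    {t : ℝ≥0} (ht : 0 < t) (hts : (t : ℝ) < s) : (t : ℝ≥0∞) ≤ dimH (π '' A) := by
  let B : ℕ → Set (ℕ → ι) := fun N =>
    {ω ∈ A | ∀ n, N ≤ n → wordProd w.1 ω n ≤ wordProd r ω n ^ (t : ℝ)}
  have hae : ∀ᵐ ω ∂(bernoulliMeasure w), ω ∈ ⋃ N, B N := by
    filter_upwards [hA, ae_forall_letter_ne_zero w] with ω hω hne
    obtain ⟨N, hN⟩ := eventually_atTop.1 ((hω.2.eventually_const_lt hts).and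
      (eventually_ge_atTop 1))
    refine mem_iUnion.2 ⟨N, hω.1, fun n hn => ?_⟩
    obtain ⟨h1, h2⟩ := hN n hn
    have hR := h.wordProd_pos ω n
    have hR1 : wordProd r ω n < 1 := by
      simpa using h.strictAnti_wordProd ω (Nat.lt_of_lt_of_le Nat.zero_lt_one h2)
    have hW : 0 < wordProd w.1 ω n :=
      Finset.prod_pos fun k _ => lt_of_le_of_ne (w.2.1 _) (hne k).symm
    rw [lt_div_iff_of_neg (Real.log_neg hR hR1)] at h1
    rw [← Real.log_le_log_iff hW (Real.rpow_pos_of_pos hR _), Real.log_rpow hR]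
    exact h1.le
  obtain ⟨N, hN⟩ : ∃ N, bernoulliMeasure w (B N) ≠ 0 := by
    by_contra! h0
    have h1 : bernoulliMeasure w (⋃ N, B N)ᶜ = 0 := hae
    have h2 : bernoulliMeasure w (⋃ N, B N) = 0 := measure_iUnion_null h0
    have h3 := measure_union_le (μ := bernoulliMeasure w) (⋃ N, B N) (⋃ N, B N)ᶜ
    rw [union_compl_self, measure_univ, h1, h2] at h3
    simp at h3
  exact (h.le_dimH_image w ht (fun ω hω => hω.2) hN).trans (dimH_mono (image_mono fun ω hω => hω.1))

end IsSeparatedCoding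

/-! ### The variational principle -/

/-- The equilibrium weights in the case where all `a i ≥ 0`: they are carried by the letters with
`a i = 0`, which are those that dominate `∑ i, b i * exp (q * a i)` as `q → -∞`. -/
theorem exists_equilibrium_weights_of_nonneg {ι : Type*} [Fintype ι] {a b : ι → ℝ}
    (hb : ∀ i, 0 < b i) (ha : ∀ i, 0 ≤ a i)
    (h : ∀ q : ℝ, 1 ≤ ∑ i, b i * Real.exp (q * a i)) :
    ∃ w : stdSimplex ℝ ι, ∑ i, w.1 i * a i = 0 ∧
      ∑ i, w.1 i * Real.log (w.1 i) ≤ ∑ i, w.1 i * Real.log (b i) := by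
  classical
  set b₀ : ι → ℝ := fun i => if a i = 0 then b i else 0 with hb₀
  set S := ∑ i, b₀ i with hS
  have hlim : Tendsto (fun q : ℝ => ∑ i, b i * Real.exp (q * a i)) atBot (𝓝 S) := by
    refine tendsto_finsetSum _ fun i _ => ?_
    by_cases hi : a i = 0
    · simp [hb₀, hi]
    · have hpos : 0 < a i := lt_of_le_of_ne (ha i) (Ne.symm hi)
      have := (Real.tendsto_exp_atBot.comp (tendsto_id.atBot_mul_const hpos)).const_mul (b i)
      simpa [hb₀, hi] using this
  have hS1 : 1 ≤ S := ge_of_tendsto hlim (Eventually.of_forall h)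
  have hS0 : 0 < S := by linarith
  refine ⟨⟨fun i => b₀ i / S, fun i => div_nonneg ?_ hS0.le, ?_⟩, ?_, ?_⟩
  · simp only [hb₀]
    split_ifs
    exacts [(hb i).le, le_rfl]
  · rw [← Finset.sum_div, div_self hS0.ne']
  · refine Finset.sum_eq_zero fun i _ => ?_
    by_cases hi : a i = 0 <;> simp [hb₀, hi]
  · refine Finset.sum_le_sum fun i _ => ?_
    by_cases hi : a i = 0
    · simp only [hb₀, hi, if_true]
      rw [Real.log_div (hb i).ne' hS0.ne']
      have := Real.log_nonneg hS1
      have := (hb i).le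
      gcongr
      linarith
    · simp [hb₀, hi]

/-- Let `b i > 0`, and suppose that `∑ i, b i * exp (q * a i) ≥ 1` for every real `q`. Then some
probability vector `w` is orthogonal to `a` and satisfies `∑ i, w i log (w i / b i) ≤ 0`: the
Gibbs weights at the minimum of the sum over `q`, or the limit of the Gibbs weights if the minimum
is approached only at infinity. -/
theorem exists_equilibrium_weights {ι : Type*} [Fintype ι] {a b : ι → ℝ}
    (hb : ∀ i, 0 < b i) (h : ∀ q : ℝ, 1 ≤ ∑ i, b i * Real.exp (q * a i)) :
    ∃ w : stdSimplex ℝ ι, ∑ i, w.1 i * a i = 0 ∧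
      ∑ i, w.1 i * Real.log (w.1 i) ≤ ∑ i, w.1 i * Real.log (b i) := by
  by_cases hneg : ∀ i, 0 ≤ a i
  · exact exists_equilibrium_weights_of_nonneg hb hneg h
  by_cases hpos : ∀ i, a i ≤ 0
  · obtain ⟨w, h1, h2⟩ := exists_equilibrium_weights_of_nonneg (a := fun i => -a i) hb
      (fun i => neg_nonneg.2 (hpos i)) fun q => by simpa using h (-q)
    exact ⟨w, by simpa using h1, h2⟩
  push Not at hneg hpos
  obtain ⟨j, hj⟩ := hneg
  obtain ⟨i, hi⟩ := hpos
  set g : ℝ → ℝ := fun q => ∑ i, b i * Real.exp (q * a i) with hg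
  have hterm : ∀ k q, b k * Real.exp (q * a k) ≤ g q := fun k q =>
    Finset.single_le_sum (f := fun i => b i * Real.exp (q * a i))
      (fun i _ => (mul_pos (hb i) (Real.exp_pos _)).le) (Finset.mem_univ k)
  have hderiv : ∀ q, HasDerivAt g (∑ i, b i * (Real.exp (q * a i) * a i)) q := fun q =>
    HasDerivAt.fun_sum fun i _ =>
      ((hasDerivAt_mul_const (a i)).exp).const_mul (b i)
  have hcont : Continuous g := continuous_iff_continuousAt.2 fun q => (hderiv q).continuousAt
  have hco : Tendsto g (cocompact ℝ) atTop := by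
    rw [cocompact_eq_atBot_atTop]
    refine Tendsto.sup ?_ ?_
    · exact tendsto_atTop_mono (hterm j) ((Real.tendsto_exp_atTop.comp
        (tendsto_id.atBot_mul_const_of_neg hj)).const_mul_atTop (hb j))
    · exact tendsto_atTop_mono (hterm i) ((Real.tendsto_exp_atTop.comp
        (tendsto_id.atTop_mul_const hi)).const_mul_atTop (hb i))
  obtain ⟨q, hq⟩ := hcont.exists_forall_le hco
  have hcrit : ∑ i, b i * (Real.exp (q * a i) * a i) = 0 :=
    IsLocalMin.hasDerivAt_eq_zero (Eventually.of_forall hq) (hderiv q)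
  have hg1 : 1 ≤ g q := h q
  have hg0 : 0 < g q := by linarith
  have hw0 : ∀ i, 0 < b i * Real.exp (q * a i) / g q := fun i =>
    div_pos (mul_pos (hb i) (Real.exp_pos _)) hg0
  have hwa : ∑ i, b i * Real.exp (q * a i) / g q * a i = 0 := by
    calc _ = (∑ i, b i * (Real.exp (q * a i) * a i)) / g q := by
          rw [Finset.sum_div]
          exact Finset.sum_congr rfl fun i _ => by ring
      _ = 0 := by rw [hcrit, zero_div]
  refine ⟨⟨fun i => b i * Real.exp (q * a i) / g q, fun i => (hw0 i).le, ?_⟩, hwa, ?_⟩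
  · rw [← Finset.sum_div]
    exact div_self hg0.ne'
  · calc ∑ i, b i * Real.exp (q * a i) / g q * Real.log (b i * Real.exp (q * a i) / g q)
        ≤ ∑ i, (b i * Real.exp (q * a i) / g q * Real.log (b i) +
            q * (b i * Real.exp (q * a i) / g q * a i)) := by
          refine Finset.sum_le_sum fun i _ => ?_
          rw [Real.log_div (mul_pos (hb i) (Real.exp_pos _)).ne' hg0.ne',
            Real.log_mul (hb i).ne' (Real.exp_pos _).ne', Real.log_exp]
          have h1 := mul_nonneg (hw0 i).le (Real.log_nonneg hg1)
          linarith
      _ = _ := by rw [Finset.sum_add_distrib, ← Finset.mul_sum, hwa, mul_zero, add_zero]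

/-! ### The multifractal formalism for separated codings -/

namespace IsSeparatedCoding

variable {ι E : Type*} [MetricSpace E] {r : ι → ℝ} {π : (ℕ → ι) → E} {D δ : ℝ}
  [Fintype ι] [MeasurableSpace ι] [DiscreteMeasurableSpace ι] [MeasurableSpace E] [BorelSpace E]

theorem localDimLevelSet_eq_image (h : IsSeparatedCoding r π D δ) (p : stdSimplex ℝ ι)
    (hp : ∀ i, 0 < p.1 i) (α : ℝ) :
    localDimLevelSet ((bernoulliMeasure p).map π) α = π '' {ω | Tendsto (fun n =>
      Real.log (wordProd p.1 ω n) / Real.log (wordProd r ω n)) atTop (𝓝 α)} := by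
  ext x
  rw [localDimLevelSet, mem_ofPred_eq, h.support_map_bernoulliMeasure p hp]
  constructor
  · rintro ⟨⟨ω, rfl⟩, hω⟩
    exact ⟨ω, (h.hasLocalDim_iff p hp ω α).1 hω, rfl⟩
  · rintro ⟨ω, hω, rfl⟩
    exact ⟨mem_range_self ω, (h.hasLocalDim_iff p hp ω α).2 hω⟩

theorem multifractalSpectrum_le (h : IsSeparatedCoding r π D δ) {p : stdSimplex ℝ ι}
    (hp : ∀ i, 0 < p.1 i) {q β : ℝ} (hβ : ∑ i, p.1 i ^ q * r i ^ (-β) = 1) (α : ℝ) :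
    multifractalSpectrum ((bernoulliMeasure p).map π) α ≤ ((q * α - β : ℝ) : EReal) := by
  rw [multifractalSpectrum, hausdorffDim]
  split_ifs with he
  · exact bot_le
  rw [h.localDimLevelSet_eq_image p hp] at he ⊢
  let v : stdSimplex ℝ ι := ⟨fun i => p.1 i ^ q * r i ^ (-β), fun i =>
    mul_nonneg (Real.rpow_nonneg (hp i).le _) (Real.rpow_nonneg (h.ratio_pos i).le _), hβ⟩
  have hv : ∀ i, 0 < v.1 i := fun i =>
    mul_pos (Real.rpow_pos_of_pos (hp i) _) (Real.rpow_pos_of_pos (h.ratio_pos i) _)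
  have hlog : ∀ ω n, 1 ≤ n → Real.log (wordProd r ω n) < 0 := fun ω n hn =>
    Real.log_neg (h.wordProd_pos ω n) (by
      simpa using h.strictAnti_wordProd ω (Nat.lt_of_lt_of_le Nat.zero_lt_one hn))
  have hlim : ∀ ω ∈ {ω | Tendsto (fun n =>
      Real.log (wordProd p.1 ω n) / Real.log (wordProd r ω n)) atTop (𝓝 α)},
      Tendsto (fun n => Real.log (wordProd v.1 ω n) / Real.log (wordProd r ω n)) atTop
        (𝓝 (q * α - β)) := by
    intro ω hω
    refine ((hω.const_mul q).sub_const β).congr' ?_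
    filter_upwards [eventually_ge_atTop 1] with n hn
    have hP : 0 < wordProd p.1 ω n := _root_.wordProd_pos hp n
    have hR := h.wordProd_pos ω n
    rw [wordProd_rpow_mul_rpow hp h.ratio_pos (fun i => rfl) ω n,
      Real.log_mul (Real.rpow_pos_of_pos hP _).ne' (Real.rpow_pos_of_pos hR _).ne',
      Real.log_rpow hP, Real.log_rpow hR]
    have := (hlog ω n hn).ne
    field_simp
    ring
  -- Cylinders have mass at most `1`, so the bound is nonnegative if the level set has a point.
  have hs : 0 ≤ q * α - β := by
    obtain ⟨_, ω, hω, rfl⟩ := Set.nonempty_iff_ne_empty.2 he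
    refine ge_of_tendsto (hlim ω hω) ?_
    filter_upwards [eventually_ge_atTop 1] with n hn
    refine div_nonneg_of_nonpos (Real.log_nonpos (_root_.wordProd_pos hv n).le ?_) (hlog ω n hn).le
    have := prob_le_one (μ := bernoulliMeasure v) (s := PiNat.cylinder ω n)
    rwa [bernoulliMeasure_cylinder, ENNReal.ofReal_le_one] at this
  calc _ ≤ ((ENNReal.ofReal (q * α - β) : ℝ≥0∞) : EReal) :=
        EReal.coe_ennreal_le_coe_ennreal_iff.2 (h.dimH_image_le_of_tendsto hv hs hlim)
    _ = _ := by rw [EReal.coe_ennreal_ofReal, max_eq_left hs]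

theorem le_multifractalSpectrum [Nonempty ι] (h : IsSeparatedCoding r π D δ)
    {p : stdSimplex ℝ ι} (hp : ∀ i, 0 < p.1 i) {α u : ℝ}
    (hu : ∀ q β : ℝ, ∑ i, p.1 i ^ q * r i ^ (-β) = 1 → u ≤ q * α - β) :
    (u : EReal) ≤ multifractalSpectrum ((bernoulliMeasure p).map π) α := by
  -- `u ≤ q α - β q` for all `q` is the hypothesis of the variational principle.
  obtain ⟨w, hw1, hw2⟩ := exists_equilibrium_weights
    (a := fun i => Real.log (p.1 i) - α * Real.log (r i)) (b := fun i => r i ^ u)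
    (fun i => Real.rpow_pos_of_pos (h.ratio_pos i) u) (fun q => by
      obtain ⟨β, hβ⟩ := exists_pressure_root hp h.ratio_pos h.ratio_lt_one q
      rw [← hβ]
      refine Finset.sum_le_sum fun i _ => ?_
      have hr := h.ratio_pos i
      have e : r i ^ u * Real.exp (q * (Real.log (p.1 i) - α * Real.log (r i))) =
          p.1 i ^ q * r i ^ (u - q * α) := by
        rw [Real.rpow_def_of_pos hr, Real.rpow_def_of_pos hr, Real.rpow_def_of_pos (hp i),
          ← Real.exp_add, ← Real.exp_add]
        congr 1
        ring
      rw [e]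
      refine mul_le_mul_of_nonneg_left ?_ (Real.rpow_nonneg (hp i).le q)
      exact Real.rpow_le_rpow_of_exponent_ge hr (h.ratio_lt_one i).le (by linarith [hu q β hβ]))
  set Λ := ∑ i, w.1 i * Real.log (r i) with hΛ
  have hΛ0 : Λ < 0 := by
    have hnonpos : ∀ i ∈ Finset.univ, w.1 i * Real.log (r i) ≤ 0 := fun i _ =>
      mul_nonpos_of_nonneg_of_nonpos (w.2.1 i)
        (Real.log_neg (h.ratio_pos i) (h.ratio_lt_one i)).le
    refine lt_of_le_of_ne (Finset.sum_nonpos hnonpos) fun h0 => ?_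
    have h1 := (Finset.sum_eq_zero_iff_of_nonpos hnonpos).1 h0
    have h2 := w.2.2
    rw [Finset.sum_eq_zero] at h2
    · exact zero_ne_one h2
    · intro i hi
      exact (mul_eq_zero.1 (h1 i hi)).resolve_right
        (Real.log_neg (h.ratio_pos i) (h.ratio_lt_one i)).ne
  have hP : ∑ i, w.1 i * Real.log (p.1 i) = α * Λ := by
    rw [hΛ, Finset.mul_sum, ← sub_eq_zero, ← Finset.sum_sub_distrib, ← hw1]
    exact Finset.sum_congr rfl fun i _ => by ring
  set H := ∑ i, w.1 i * Real.log (w.1 i) with hH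
  have hHu : u ≤ H / Λ := by
    rw [le_div_iff_of_neg hΛ0, hΛ, Finset.mul_sum]
    refine hw2.trans (Finset.sum_le_sum fun i _ => ?_)
    rw [Real.log_rpow (h.ratio_pos i)]
    exact le_of_eq (by ring)
  have hquot : ∀ (f : ι → ℝ) (ω : ℕ → ι), (∀ k, f (ω k) ≠ 0) →
      Tendsto (fun n : ℕ => (∑ k ∈ Finset.range n, Real.log (f (ω k))) / n) atTop
        (𝓝 (∑ i, w.1 i * Real.log (f i))) →
      Tendsto (fun n : ℕ => (∑ k ∈ Finset.range n, Real.log (r (ω k))) / n) atTop (𝓝 Λ) →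
      Tendsto (fun n => Real.log (wordProd f ω n) / Real.log (wordProd r ω n)) atTop
        (𝓝 ((∑ i, w.1 i * Real.log (f i)) / Λ)) := by
    intro f ω hf h1 h2
    refine (h1.div h2 hΛ0.ne).congr' ?_
    filter_upwards [eventually_ge_atTop 1] with n hn
    have hn0 : (n : ℝ) ≠ 0 := by positivity
    rw [Pi.div_apply, div_div_div_cancel_right₀ hn0, log_wordProd hf,
      log_wordProd fun k => (h.ratio_pos (ω k)).ne']
  have hae : ∀ᵐ ω ∂(bernoulliMeasure w), ω ∈ {ω | Tendsto (fun n =>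
        Real.log (wordProd p.1 ω n) / Real.log (wordProd r ω n)) atTop (𝓝 α)} ∧
      Tendsto (fun n => Real.log (wordProd w.1 ω n) / Real.log (wordProd r ω n)) atTop
        (𝓝 (H / Λ)) := by
    filter_upwards [ae_tendsto_letter_average w fun i => Real.log (p.1 i),
      ae_tendsto_letter_average w fun i => Real.log (r i),
      ae_tendsto_letter_average w fun i => Real.log (w.1 i),
      ae_forall_letter_ne_zero w] with ω h1 h2 h3 h4
    refine ⟨?_, hquot w.1 ω h4 h3 h2⟩
    have := hquot p.1 ω (fun k => (hp _).ne') h1 h2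
    rwa [hP, mul_div_assoc, div_self hΛ0.ne, mul_one] at this
  rw [multifractalSpectrum, hausdorffDim, h.localDimLevelSet_eq_image p hp, if_neg]
  · refine EReal.ge_of_forall_gt_iff_ge.1 fun c hc => ?_
    rcases le_or_gt c 0 with hc0 | hc0
    · exact (EReal.coe_nonpos.2 hc0).trans (EReal.coe_ennreal_nonneg _)
    · have hcu : c < u := EReal.coe_lt_coe_iff.1 hc
      have := h.le_dimH_image_of_ae_tendsto hae (t := ⟨c, hc0.le⟩) hc0 (hcu.trans_le hHu)
      exact EReal.coe_ennreal_le_coe_ennreal_iff.2 this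
  · obtain ⟨ω, hω⟩ := hae.exists
    exact Set.nonempty_iff_ne_empty.1 ⟨π ω, ω, hω.1, rfl⟩

theorem satisfiesMultifractalFormalism [Nonempty ι] (h : IsSeparatedCoding r π D δ)
    {p : stdSimplex ℝ ι} (hp : ∀ i, 0 < p.1 i) :
    SatisfiesMultifractalFormalism ((bernoulliMeasure p).map π) := by
  intro α
  have hval : ∀ q β : ℝ, ∑ i, p.1 i ^ q * r i ^ (-β) = 1 →
      ((q * α : ℝ) : EReal) - lqSpectrum ((bernoulliMeasure p).map π) q =
        ((q * α - β : ℝ) : EReal) := fun q β hβ => by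
    rw [h.lqSpectrum_eq hp hβ, EReal.coe_sub]
  refine le_antisymm (le_iInf fun q => ?_) ?_
  · obtain ⟨β, hβ⟩ := exists_pressure_root hp h.ratio_pos h.ratio_lt_one q
    rw [hval q β hβ]
    exact h.multifractalSpectrum_le hp hβ α
  · have hle : ∀ q β : ℝ, ∑ i, p.1 i ^ q * r i ^ (-β) = 1 →
        concaveConjugate (lqSpectrum ((bernoulliMeasure p).map π)) α ≤
          ((q * α - β : ℝ) : EReal) := fun q β hβ => by
      rw [← hval q β hβ]
      exact iInf_le _ q
    obtain ⟨β₀, hβ₀⟩ := exists_pressure_root hp h.ratio_pos h.ratio_lt_one 0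
    generalize concaveConjugate (lqSpectrum ((bernoulliMeasure p).map π)) α = c at hle
    induction c with
    | bot => exact bot_le
    | top => exact absurd (hle 0 β₀ hβ₀) (by simp)
    | coe u => exact h.le_multifractalSpectrum hp fun q β hβ => EReal.coe_le_coe_iff.1 (hle q β hβ)

end IsSeparatedCoding

/-! ### Self-similar sets with strong separation -/

namespace SimilarityIFS

section Coding

variable {ι E : Type*} [MetricSpace E]

theorem wordMap_succ (F : SimilarityIFS ι E) (ω : ℕ → ι) (n : ℕ) (x : E) :
    F.wordMap ω (n + 1) x = F.wordMap ω n (F.map (ω n) x) := rfl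

theorem dist_wordMap (F : SimilarityIFS ι E) {r : ι → ℝ}
    (hr : ∀ i x y, dist (F.map i x) (F.map i y) = r i * dist x y) (ω : ℕ → ι) (n : ℕ) (x y : E) :
    dist (F.wordMap ω n x) (F.wordMap ω n y) = wordProd r ω n * dist x y := by
  induction n generalizing x y with
  | zero => simp [wordMap]
  | succ n ih => rw [wordMap_succ, wordMap_succ, ih, hr, wordProd_succ, mul_assoc]

theorem wordMap_congr (F : SimilarityIFS ι E) {ω ω' : ℕ → ι} {n : ℕ}
    (h : ω' ∈ PiNat.cylinder ω n) (x : E) : F.wordMap ω' n x = F.wordMap ω n x := by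
  induction n generalizing x with
  | zero => rfl
  | succ n ih =>
    rw [wordMap_succ, wordMap_succ, PiNat.mem_cylinder_iff.1 h n n.lt_succ_self]
    exact ih (PiNat.cylinder_anti ω n.le_succ h) _

theorem wordMap_mem (F : SimilarityIFS ι E) {L : Set E} (hL : ∀ i, MapsTo (F.map i) L L)
    (ω : ℕ → ι) (n : ℕ) {x : E} (hx : x ∈ L) : F.wordMap ω n x ∈ L := by
  induction n generalizing x with
  | zero => exact hx
  | succ n ih => exact ih (hL _ hx)

/-- A coding map is equivariant: the coded point is the image under the first `n` maps of the point
coded by the remaining letters. -/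
theorem coding_eq_wordMap (F : SimilarityIFS ι E) {π : (ℕ → ι) → E}
    (h : ∀ i ω, π (consWord i ω) = F.map i (π ω)) (ω : ℕ → ι) (n : ℕ) :
    π ω = F.wordMap ω n (π fun k => ω (n + k)) := by
  induction n with
  | zero => simp [wordMap]
  | succ n ih =>
    rw [ih, wordMap_succ, ← h]
    congr 2
    funext k
    cases k with
    | zero => rfl
    | succ k => exact congrArg ω (by omega)

end Coding

variable {ι E : Type*} [Fintype ι] [Nonempty ι] [MetricSpace E] [CompleteSpace E]
  [SecondCountableTopology E] [Nonempty E] [MeasurableSpace E] [BorelSpace E]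
  [MeasurableSpace ι] [DiscreteMeasurableSpace ι]

/-- Strong separation, in the form that there is a nonempty compact set mapped into itself by all
the maps with pairwise disjoint images, provides a separated coding; it carries each Bernoulli
measure to the self-similar measure with the same weights. In this form the hypothesis is inherited
by subfamilies. -/
theorem exists_isSeparatedCoding (F : SimilarityIFS ι E) {L : Set E} (hLc : IsCompact L)
    (hLne : L.Nonempty) (hL : ∀ i, MapsTo (F.map i) L L)
    (hdisj : Pairwise fun i j => Disjoint (F.map i '' L) (F.map j '' L)) :
    ∃ (r : ι → ℝ) (π : (ℕ → ι) → E) (D δ : ℝ), IsSeparatedCoding r π D δ ∧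
      ∀ p : stdSimplex ℝ ι, F.selfSimilarMeasure p = (bernoulliMeasure p).map π := by
  let _ : TopologicalSpace ι := ⊥
  have _ : DiscreteTopology ι := ⟨rfl⟩
  choose r hr0 hr1 hr using F.isSimilarity
  obtain ⟨π, hπ, hunif⟩ := F.exists_coding
  obtain ⟨x₀, hx₀⟩ := hLne
  have hlim : ∀ ω, Tendsto (fun n => F.wordMap ω n x₀) atTop (𝓝 (π ω)) :=
    fun ω => hπ ω (fun _ => x₀) 0 (by simp)
  have hcont : Continuous π := (hunif x₀).continuous (Frequently.of_forall fun n =>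
    (F.continuous_wordMap n).comp (Continuous.prodMk_left x₀))
  have hcons : ∀ i ω, π (consWord i ω) = F.map i (π ω) := F.coding_cons hlim
  have hmem : ∀ ω, π ω ∈ L := fun ω => hLc.isClosed.mem_of_tendsto (hlim ω)
    (Eventually.of_forall fun n => F.wordMap_mem hL ω n hx₀)
  obtain ⟨D, hD0, hD⟩ : ∃ D : ℝ, 0 < D ∧ ∀ x ∈ L, ∀ y ∈ L, dist x y ≤ D := by
    obtain ⟨D, hD⟩ := Metric.isBounded_iff.1 hLc.isBounded
    exact ⟨max D 1, by positivity, fun x hx y hy => (hD hx hy).trans (le_max_left _ _)⟩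
  obtain ⟨δ, hδ0, hδ⟩ : ∃ δ : ℝ, 0 < δ ∧ ∀ i j, i ≠ j → ∀ x ∈ F.map i '' L, ∀ y ∈ F.map j '' L,
      δ ≤ dist x y := by
    have hex : ∀ z : ι × ι, ∃ δ : ℝ, 0 < δ ∧ (z.1 ≠ z.2 → ∀ x ∈ F.map z.1 '' L,
        ∀ y ∈ F.map z.2 '' L, δ ≤ dist x y) := by
      rintro ⟨i, j⟩
      by_cases hij : i = j
      · exact ⟨1, one_pos, fun h => absurd hij h⟩
      · obtain ⟨δ, hδ0, hδ⟩ := Metric.exists_pos_forall_lt_edist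
          (hLc.image (F.continuous_map i)) (hLc.image (F.continuous_map j)).isClosed (hdisj hij)
        refine ⟨δ, NNReal.coe_pos.2 hδ0, fun _ x hx y hy => ?_⟩
        have := hδ x hx y hy
        rw [edist_nndist, ENNReal.coe_lt_coe] at this
        exact this.le
    choose δ hδ0 hδ using hex
    obtain ⟨z, hz⟩ := Finite.exists_min δ
    exact ⟨δ z, hδ0 z, fun i j hij x hx y hy => (hz (i, j)).trans (hδ (i, j) hij x hx y hy)⟩
  have hS : IsSeparatedCoding r π D δ :=
    { ratio_pos := hr0
      ratio_lt_one := hr1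
      diam_pos := hD0
      gap_pos := hδ0
      isCompact_range := _root_.isCompact_range hcont
      dist_le := fun ω ω' n h => by
        rw [F.coding_eq_wordMap hcons ω n, F.coding_eq_wordMap hcons ω' n, F.wordMap_congr h,
          F.dist_wordMap hr, mul_comm]
        exact mul_le_mul_of_nonneg_right (hD _ (hmem _) _ (hmem _)) (wordProd_pos hr0 n).le
      le_dist := fun ω ω' n h hne => by
        rw [F.coding_eq_wordMap hcons ω (n + 1), F.coding_eq_wordMap hcons ω' (n + 1),
          wordMap_succ, wordMap_succ, F.wordMap_congr h, F.dist_wordMap hr, mul_comm]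
        exact mul_le_mul_of_nonneg_left (hδ _ _ hne _ (mem_image_of_mem _ (hmem _)) _
          (mem_image_of_mem _ (hmem _))) (wordProd_pos hr0 n).le }
  refine ⟨r, π, D, δ, hS, fun p => ?_⟩
  refine (F.existsUnique_isInvariantMeasure p.2).unique
    (F.isInvariantMeasure_selfSimilarMeasure p)
    ⟨Measure.isProbabilityMeasure_map hcont.measurable.aemeasurable, ?_⟩
  ext A hA
  rw [Measure.finsetSum_apply, Measure.map_apply hcont.measurable hA,
    bernoulliMeasure_eq_sum_map_consWord p, Measure.finsetSum_apply]
  refine Finset.sum_congr rfl fun i _ => ?_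
  rw [← bernoulliMeasure_eq_sum_map_consWord p, Measure.smul_apply, Measure.smul_apply,
    Measure.map_apply (measurable_consWord i) (hcont.measurable hA),
    Measure.map_apply (F.continuous_map i).measurable hA,
    Measure.map_apply hcont.measurable ((F.continuous_map i).measurable hA)]
  congr 2
  ext ω
  simp only [mem_preimage, hcons]

end SimilarityIFS

theorem mainTheorem1 {ι : Type*} [Fintype ι] [Nonempty ι] {d : ℕ}
    (F : SimilarityIFS ι (EuclideanSpace ℝ (Fin d))) (hF : F.StrongSeparation)
    (p : stdSimplex ℝ ι) :
    SatisfiesMultifractalFormalism (F.selfSimilarMeasure p) := by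
  classical
  -- Letters of weight zero do not contribute to the measure, and are removed from the system.
  let κ := {i : ι // 0 < p.1 i}
  let _ : MeasurableSpace κ := ⊤
  have _ : DiscreteMeasurableSpace κ := ⟨fun _ => trivial⟩
  have hsum : ∀ {M : Type} [AddCommMonoid M] (f : ι → M), (∀ i, p.1 i = 0 → f i = 0) →
      ∑ i : κ, f i = ∑ i, f i := fun f hf => by
    rw [← Finset.sum_subtype (Finset.univ.filter fun i => 0 < p.1 i) (by simp)]
    refine Finset.sum_subset (Finset.filter_subset _ _) fun i _ hi => hf i ?_
    exact le_antisymm (not_lt.1 (by simpa using hi)) (p.2.1 i)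
  let F' : SimilarityIFS κ (EuclideanSpace ℝ (Fin d)) :=
    ⟨fun i => F.map i, fun i => F.isSimilarity i⟩
  let p' : stdSimplex ℝ κ := ⟨fun i => p.1 i, fun i => i.2.le, by
    rw [← p.2.2]; exact hsum p.1 fun i hi => hi⟩
  have hκ : Nonempty κ := by
    by_contra hemp
    rw [not_nonempty_iff] at hemp
    have := p'.2.2
    simp at this
  obtain ⟨hKc, hKne, hK⟩ := F.isAttractor_attractor
  obtain ⟨r, π, D, δ, hS, hμ⟩ := F'.exists_isSeparatedCoding hKc hKne
    (fun i x hx => hK ▸ mem_iUnion.2 ⟨i, x, hx, rfl⟩)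
    (fun i j hij => hF (Subtype.coe_injective.ne hij))
  have heq : F.selfSimilarMeasure p = F'.selfSimilarMeasure p' := by
    obtain ⟨h1, h2⟩ := F'.isInvariantMeasure_selfSimilarMeasure p'
    refine (F.existsUnique_isInvariantMeasure p.2).unique
      (F.isInvariantMeasure_selfSimilarMeasure p) ⟨h1, h2.trans ?_⟩
    exact hsum (fun i => ENNReal.ofReal (p.1 i) • (F'.selfSimilarMeasure p').map (F.map i))
      fun i hi => by simp [hi]
  rw [heq, hμ]
  exact hS.satisfiesMultifractalFormalism fun i => i.2
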